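/- **Setting.** Let $\mathfrak g$ be a finite-dimensional simple complex Lie algebra with a Cartan subalgebra, root system $\Phi$, simple roots $\Delta$, positive roots $\Phi^+$, root lattice $Q$ and weight lattice $\Lambda$. Let $(\cdot|\cdot)$ be the Weyl-invariant form with $(\alpha|\alpha)=2$ for short roots (all roots count as short if they have the same length). Let $M$ be a lattice with $Q\subseteq M\subseteq\Lambda$. Let $\ell>1$ be an odd integer, coprime to $3$ if $\mathfrak g$ is of type $G_2$. Let $\varepsilon\in\mathbb C$ be a primitive $\ell$-th root of $1$, and put $\varepsilon_\alpha=\varepsilon^{(\alpha|\alpha)/2}$. $U_\varepsilon^M(\mathfrak g)$ is the complex algebra with generators $E_\alpha,F_\alpha$ ($\alpha\in\Delta$), $K_\mu$ ($\mu\in M$) and relations $K_0=1$, $K_\mu K_\nu=K_{\mu+\nu}$, $K_\mu E_\alpha=\varepsilon^{(\mu|\alpha)}E_\alpha K_\mu$, $K_\mu F_\alpha=\varepsilon^{-(\mu|\alpha)}F_\alpha K_\mu$, $E_\alpha F_\beta-F_\beta E_\alpha=\delta_{\alpha\beta}\frac{K_\alpha-K_{-\alpha}}{\varepsilon_\alpha-\varepsilon_\alpha^{-1}}$,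 and the quantum Serre relations: for $\alpha\ne\beta$, $\sum_{a+b=1-2(\alpha|\beta)/(\alpha|\alpha)}(-1)^a{a+b\brack a}_{\varepsilon_\alpha}E_\alpha^aE_\beta E_\alpha^b=0$ and the same with $F$ in place of $E$. Here ${n\brack k}_q$ is the Gaussian binomial in its symmetric form, i.e. the value at $q$ of the Laurent polynomial $\frac{[n]!}{[k]!\,[n-k]!}$, where $[n]=\frac{q^n-q^{-n}}{q-q^{-1}}$. Fix a reduced decomposition $w_0=s_{i_1}\cdots s_{i_r}$ of the longest element of the Weyl group. It gives an enumeration $\beta_k=s_{i_1}\cdots s_{i_{k-1}}(\alpha_{i_k})$ of $\Phi^+$, and root vectors $E_{\beta_k}=T_{i_1}\cdots T_{i_{k-1}}(E_{\alpha_{i_k}})$, $F_{\beta_k}=T_{i_1}\cdots T_{i_{k-1}}(F_{\alpha_{i_k}})$, where the $T_i$ are Lusztig's braid group automorphisms. The $\ell$-center $Z_0^M(\mathfrak g)$ is the (central) subalgebra generated by $E_\gamma^\ell,F_\gamma^\ell$ ($\gamma\in\Phi^+$) and $K_\mu^\ell$ ($\mu\in M$). An $\ell$-character is an algebra homomorphism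 $\eta\colon Z_0^M(\mathfrak g)\to\mathbb C$, and $U_\eta^M(\mathfrak g)=U_\varepsilon^M(\mathfrak g)/(\ker\eta)\,U_\varepsilon^M(\mathfrak g)$. Let $G_M$ be the complex semisimple group with Lie algebra $\mathfrak g$ and isogeny type $M$. Its maximal torus is $T_M=\operatorname{Hom}(M,\mathbb C^\times)$. For $\gamma\in\Phi$ let $x_\gamma\colon\mathbb C\to G_M$, $x_\gamma(s)=\exp(s e_\gamma)$, be the one-parameter root subgroup attached to a nonzero root vector $e_\gamma\in\mathfrak g_\gamma$. The map $\pi_M$ from $\ell$-characters to $G_M$ is $$\pi_M(\eta)=(t^{-1}u)^{-1}(tv)=u^{-1}t^2v,$$ where $t\in T_M$ is $\mu\mapsto\eta(K_\mu^\ell)$, $v=x_{\beta_1}(\eta(E_{\beta_1}^\ell))\cdots x_{\beta_r}(\eta(E_{\beta_r}^\ell))$ and $u=x_{-\beta_r}(\eta(F_{\beta_r}^\ell))\cdots x_{-\beta_1}(\eta(F_{\beta_1}^\ell))$. **Proposition.** Let $m=|M/Q|$ and $d=\gcd(\ell,m)$. Let $\eta$ be an $\ell$-character such that $z:=\pi_M(\eta)$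 lies in the center $Z(G_M)$. Then $U_\eta^M(\mathfrak g)$ has a $1$-dimensional representation if and only if the order of $z$ divides $m/d$. -/

import Mathlib

/-! Quantized enveloping algebras at a root of unity for an arbitrary isogeny type, their `ℓ`-center,
the reduced quotients, the complex semisimple group of the same isogeny type, and the map from
`ℓ`-characters to that group. -/

noncomputable section

namespace QEA

open Module

/-! ### `q`-numbers -/

/-- The `q`-integer `[n]_q = (q ^ n - q ^ (-n)) / (q - q ^ (-1))`. -/
def qInt (q : ℂ) (n : ℕ) : ℂ := (q ^ n - (q⁻¹) ^ n) / (q - q⁻¹)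

/-- The `q`-factorial `[n]_q! = [n]_q [n-1]_q ⋯ [1]_q`. -/
def qFactorial (q : ℂ) : ℕ → ℂ
  | 0 => 1
  | n + 1 => qInt q (n + 1) * qFactorial q n

/-- The symmetric `q`-binomial coefficient, i.e. the value at `q` of the Laurent polynomial
`[n]! / ([k]! [n-k]!)`. It is given by the Pascal rule, since at a root of unity the quotient of the
values may be `0 / 0`. -/
def qBinom (q : ℂ) : ℕ → ℕ → ℂ
  | _, 0 => 1
  | 0, _ + 1 => 0
  | n + 1, k + 1 => q ^ (k + 1) * qBinom q n (k + 1) + q ^ ((k : ℤ) - (n : ℤ)) * qBinom q n k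

theorem qBinom_eq_zero_of_lt (q : ℂ) : ∀ {n k : ℕ}, n < k → qBinom q n k = 0
  | 0, 0, h => absurd h (lt_irrefl _)
  | 0, _ + 1, _ => by simp [qBinom]
  | n + 1, 0, h => absurd h (Nat.not_lt_zero _)
  | n + 1, k + 1, h => by
      have h1 : n < k := Nat.lt_of_succ_lt_succ h
      simp [qBinom, qBinom_eq_zero_of_lt q h1, qBinom_eq_zero_of_lt q (Nat.lt_succ_of_lt h1)]

/-- The `q`-binomial coefficient is the expected quotient of `q`-factorials. -/
theorem qBinom_mul (q : ℂ) (hq : q ≠ 0) :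
    ∀ n a c : ℕ, a + c = n →
      qBinom q n a * (qFactorial q a * qFactorial q c) = qFactorial q n := by
  intro n
  induction n with
  | zero =>
    intro a c hac
    obtain ⟨rfl, rfl⟩ : a = 0 ∧ c = 0 := by omega
    simp [qBinom, qFactorial]
  | succ n ih =>
    intro a c hac
    rcases a with _ | a
    · obtain rfl : c = n + 1 := by omega
      simp [qBinom, qFactorial]
    · have h2 := ih a c (by omega)
      have key : q ^ (a + 1) * qInt q c + q ^ ((a : ℤ) - (n : ℤ)) * qInt q (a + 1)
          = qInt q (n + 1) := by
        obtain rfl : n = a + c := by omega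
        have e : q ^ ((a : ℤ) - ((a + c : ℕ) : ℤ)) = (q⁻¹) ^ c := by
          rw [show (a : ℤ) - ((a + c : ℕ) : ℤ) = -(c : ℤ) by push_cast; ring]
          simp
        rw [e]
        unfold qInt
        rw [← mul_div_assoc, ← mul_div_assoc, ← add_div]
        congr 1
        simp only [inv_pow]
        field_simp
        ring
      rcases c with _ | c
      · obtain rfl : a = n := by omega
        have h3 : qBinom q a (a + 1) = 0 := qBinom_eq_zero_of_lt q (Nat.lt_succ_self a)
        have h7 : qBinom q (a + 1) (a + 1) = q ^ (a + 1) * qBinom q a (a + 1)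
            + q ^ ((a : ℤ) - (a : ℤ)) * qBinom q a a := by rw [qBinom]
        rw [h7, h3]
        simp only [qFactorial] at h2 ⊢
        simp only [sub_self, zpow_zero, one_mul, mul_one, mul_zero, zero_add] at h2 ⊢
        calc _ = qInt q (a + 1) * (qBinom q a a * qFactorial q a) := by ring
          _ = _ := by rw [h2]
      · have h1 := ih (a + 1) c (by omega)
        have h5 : qBinom q (n + 1) (a + 1) = q ^ (a + 1) * qBinom q n (a + 1)
            + q ^ ((a : ℤ) - (n : ℤ)) * qBinom q n a := by rw [qBinom]
        have h6 : qFactorial q (n + 1) = qInt q (n + 1) * qFactorial q n := by rw [qFactorial]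
        rw [h5, h6, ← key, add_mul, add_mul]
        simp only [qFactorial] at h1 h2 ⊢
        congr 1
        · rw [← h1]; ring
        · rw [← h2]; ring

/-! ### Lattices between the root lattice and the weight lattice -/

variable {ι V N : Type*} [AddCommGroup V] [Module ℂ V] [AddCommGroup N] [Module ℂ N]
variable (P : RootPairing ι ℂ V N) [P.IsCrystallographic]

/-- The weight lattice `Λ`. -/
def weightLattice (P : RootPairing ι ℂ V N) : AddSubgroup V where
  carrier := {μ | ∀ i, ∃ k : ℤ, P.toLinearMap μ (P.coroot i) = (k : ℂ)}
  zero_mem' := fun i => ⟨0, by simp⟩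
  add_mem' := by
    intro μ ν hμ hν i
    obtain ⟨a, ha⟩ := hμ i
    obtain ⟨c, hc⟩ := hν i
    exact ⟨a + c, by simp [ha, hc]⟩
  neg_mem' := by
    intro μ hμ i
    obtain ⟨a, ha⟩ := hμ i
    exact ⟨-a, by simp [ha]⟩

/-- The integer `⟨μ, α_i^∨⟩` for a weight `μ` and a root `α_i`. -/
def wtPairing {P : RootPairing ι ℂ V N} (μ : weightLattice P) (i : ι) : ℤ := (μ.2 i).choose

theorem wtPairing_spec {P : RootPairing ι ℂ V N} (μ : weightLattice P) (i : ι) :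
    P.toLinearMap (μ : V) (P.coroot i) = (wtPairing μ i : ℂ) := (μ.2 i).choose_spec

/-- A root, as an element of the weight lattice. -/
def rootWeight (i : ι) : weightLattice P :=
  ⟨P.root i, fun j => ⟨P.pairingIn ℤ i j, by
    rw [P.root_coroot_eq_pairing]
    exact (P.algebraMap_pairingIn ℤ i j).symm⟩⟩

/-- The root lattice `Q`, inside the weight lattice. -/
def rootLattice : AddSubgroup (weightLattice P) :=
  AddSubgroup.closure (Set.range (rootWeight P))

/-- A lattice `M` with `Q ⊆ M ⊆ Λ`. -/
structure IsogenyLattice where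
  lattice : AddSubgroup (weightLattice P)
  rootLattice_le : rootLattice P ≤ lattice

variable {P}

/-- A root, as an element of `M`. -/
def IsogenyLattice.root (M : IsogenyLattice P) (i : ι) : M.lattice :=
  ⟨rootWeight P i, M.rootLattice_le (AddSubgroup.subset_closure ⟨i, rfl⟩)⟩

/-- The index `|M / Q|`. -/
def IsogenyLattice.index (M : IsogenyLattice P) : ℕ :=
  Nat.card (M.lattice ⧸ (rootLattice P).addSubgroupOf M.lattice)

/-- The reflection `μ ↦ μ - ⟨μ, α_i^∨⟩ α_i` on `M`. -/
def IsogenyLattice.reflect (M : IsogenyLattice P) (i : ι) (μ : M.lattice) : M.lattice :=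
  μ - wtPairing (μ : weightLattice P) i • M.root i

variable [Fintype ι]

variable (P) in
/-- The number `(α_i | α_i) / 2`, for the Weyl group invariant form normalised so that `(α | α) = 2`
for the shortest roots `α`: the quotient of the squared length of `α_i` by the least squared
length of a root, for the canonical invariant form. For an irreducible root system it is `1`, `2` or
`3` and the integer division is exact, see `halfNorm_mul`. -/
def halfNorm (i : ι) : ℤ :=
  (P.posRootForm ℤ).rootLength i /
    (Finset.univ : Finset ι).inf' ⟨i, Finset.mem_univ i⟩ (P.posRootForm ℤ).rootLength

theorem halfNorm_mul [P.IsRootSystem] [P.IsReduced] [P.IsIrreducible] (i : ι) :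
    halfNorm P i *
      (Finset.univ : Finset ι).inf' ⟨i, Finset.mem_univ i⟩ (P.posRootForm ℤ).rootLength =
      (P.posRootForm ℤ).rootLength i := by
  set B := P.posRootForm ℤ with hB
  obtain ⟨j, -, hj⟩ := Finset.exists_mem_eq_inf' (s := (Finset.univ : Finset ι))
    ⟨i, Finset.mem_univ i⟩ B.rootLength
  have hmin : B.rootLength j ≤ B.rootLength i := by
    rw [← hj]
    exact Finset.inf'_le _ (Finset.mem_univ i)
  obtain ⟨k, hk1, hk2⟩ := P.exists_form_eq_form_and_form_ne_zero B.toInvariantForm i j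
  have hkj : B.rootLength k = B.rootLength j := by
    have := hk1
    change B.form _ _ = B.form _ _ at this
    rw [← B.algebraMap_rootLength, ← B.algebraMap_rootLength] at this
    exact_mod_cast this
  have hp : P.pairingIn ℤ i k ≠ 0 := by
    intro h0
    have h1 := B.two_mul_apply_root_root (i := i) (j := k)
    rw [← P.algebraMap_pairingIn ℤ, h0] at h1
    apply hk2
    change B.form _ _ = 0
    simpa using h1
  have hsw := B.pairingIn_mul_eq_pairingIn_mul_swap k i
  have hmem := P.pairingIn_pairingIn_mem_set_of_isCrystal_of_isRed i k
  have hpos := B.rootLength_pos j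
  have hdvd : B.rootLength j ∣ B.rootLength i := by
    rw [hkj] at hsw
    simp only [Set.mem_insert_iff, Set.mem_singleton_iff, Prod.mk.injEq] at hmem
    rcases hmem with h | h | h | h | h | h | h | h | h | h | h | h | h <;>
    rw [h.1, h.2] at hsw
    · exact absurd h.1 hp
    all_goals first
      | (exact ⟨1, by lia⟩)
      | (exact ⟨2, by lia⟩)
      | (exact ⟨3, by lia⟩)
  unfold halfNorm
  rw [← hB, hj]
  exact Int.ediv_mul_cancel hdvd

/-- The integer `(μ | α_i)`, i.e. `(α_i | α_i) / 2 * ⟨μ, α_i^∨⟩`, for a weight `μ` and a root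
`α_i`. -/
def formRoot (μ : weightLattice P) (i : ι) : ℤ := halfNorm P i * wtPairing μ i

/-! ### The quantized enveloping algebra -/

/-- The generators `E_α`, `F_α` (`α` simple) and `K_μ` (`μ ∈ M`). -/
inductive Gen (b : P.Base) (M : IsogenyLattice P) : Type _
  | E (i : b.support) : Gen b M
  | F (i : b.support) : Gen b M
  | K (μ : M.lattice) : Gen b M

/-- `ε_α = ε ^ ((α | α) / 2)`. -/
def qRoot (P : RootPairing ι ℂ V N) [P.IsCrystallographic] (ε : ℂ) (i : ι) : ℂ := ε ^ halfNorm P i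

/-- The free algebra on the generators. -/
abbrev Free (b : P.Base) (M : IsogenyLattice P) := FreeAlgebra ℂ (Gen b M)

section Generators

variable (b : P.Base) (M : IsogenyLattice P)

def fE (i : b.support) : Free b M := FreeAlgebra.ι ℂ (Gen.E i)

def fF (i : b.support) : Free b M := FreeAlgebra.ι ℂ (Gen.F i)

def fK (μ : M.lattice) : Free b M := FreeAlgebra.ι ℂ (Gen.K μ)

end Generators

/-- The exponent `1 - 2 (α | β) / (α | α)` for `α = α_i`, `β = α_j` (used for `i ≠ j`). -/
def serreExp {b : P.Base} (i j : b.support) : ℕ :=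
  (1 - P.pairingIn ℤ (j : ι) (i : ι)).toNat

/-- The defining relations of `U_ε^M(𝔤)`. -/
inductive Rel (ε : ℂ) (b : P.Base) (M : IsogenyLattice P) : Free b M → Free b M → Prop
  | K_zero : Rel ε b M (fK b M 0) 1
  | K_mul (μ ν : M.lattice) : Rel ε b M (fK b M μ * fK b M ν) (fK b M (μ + ν))
  | K_E (μ : M.lattice) (i : b.support) :
      Rel ε b M (fK b M μ * fE b M i) (ε ^ formRoot (μ : weightLattice P) i • (fE b M i * fK b M μ))
  | K_F (μ : M.lattice) (i : b.support) :
      Rel ε b M (fK b M μ * fF b M i)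
        (ε ^ (-formRoot (μ : weightLattice P) i) • (fF b M i * fK b M μ))
  | E_F_self (i : b.support) :
      Rel ε b M (fE b M i * fF b M i - fF b M i * fE b M i)
        ((qRoot P ε i - (qRoot P ε i)⁻¹)⁻¹ • (fK b M (M.root i) - fK b M (-M.root i)))
  | E_F_ne (i j : b.support) (h : i ≠ j) :
      Rel ε b M (fE b M i * fF b M j - fF b M j * fE b M i) 0
  | serre_E (i j : b.support) (h : i ≠ j) :
      Rel ε b M (∑ p ∈ Finset.HasAntidiagonal.antidiagonal (serreExp i j),
        ((-1) ^ p.1 * qBinom (qRoot P ε i) (p.1 + p.2) p.1) •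
          (fE b M i ^ p.1 * fE b M j * fE b M i ^ p.2)) 0
  | serre_F (i j : b.support) (h : i ≠ j) :
      Rel ε b M (∑ p ∈ Finset.HasAntidiagonal.antidiagonal (serreExp i j),
        ((-1) ^ p.1 * qBinom (qRoot P ε i) (p.1 + p.2) p.1) •
          (fF b M i ^ p.1 * fF b M j * fF b M i ^ p.2)) 0

/-- The De Concini-Kac quantized enveloping algebra `U_ε^M(𝔤)`. -/
abbrev U (ε : ℂ) (b : P.Base) (M : IsogenyLattice P) := RingQuot (Rel ε b M)

/-- The projection from the free algebra on the generators to `U_ε^M(𝔤)`. -/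
def toU (ε : ℂ) (b : P.Base) (M : IsogenyLattice P) : Free b M →ₐ[ℂ] U ε b M :=
  RingQuot.mkAlgHom ℂ (Rel ε b M)

/-- The element `K_μ` of `U_ε^M(𝔤)`. -/
def uK (ε : ℂ) (b : P.Base) (M : IsogenyLattice P) (μ : M.lattice) : U ε b M :=
  toU ε b M (fK b M μ)

theorem uK_zero (ε : ℂ) (b : P.Base) (M : IsogenyLattice P) : uK ε b M 0 = 1 := by
  simpa [uK, toU] using RingQuot.mkAlgHom_rel ℂ (Rel.K_zero (ε := ε) (b := b) (M := M))

theorem uK_add (ε : ℂ) (b : P.Base) (M : IsogenyLattice P) (μ ν : M.lattice) :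
    uK ε b M (μ + ν) = uK ε b M μ * uK ε b M ν := by
  simpa [uK, toU] using (RingQuot.mkAlgHom_rel ℂ (Rel.K_mul (ε := ε) (b := b) μ ν)).symm

/-! ### Root vectors -/

/-- The Weyl group element `s_{i_1} ⋯ s_{i_r}` of a word in the simple roots, as a permutation of
the roots. -/
def wordPerm {b : P.Base} (w : List b.support) : Equiv.Perm ι :=
  (w.map fun i => P.reflectionPerm (i : ι)).prod

/-- The word `w` is a reduced decomposition of the longest element `w₀` of the Weyl group, i.e. of
the element that maps all positive roots to negative ones. -/
structure IsReducedLongest {b : P.Base} (w : List b.support) : Prop where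
  not_isPos : ∀ i : ι, b.IsPos i → ¬ b.IsPos (wordPerm w i)
  length_le : ∀ w' : List b.support, wordPerm w' = wordPerm w → w.length ≤ w'.length

/-- The `k`-th positive root `β_k = s_{i_1} ⋯ s_{i_{k-1}} (α_{i_k})` of a word (here `k` is counted
from zero). -/
def wordRoot {b : P.Base} (w : List b.support) (k : Fin w.length) : ι :=
  wordPerm (w.take k) (w.get k : ι)

open Classical in
/-- Lusztig's braid group operator `T_i`, written on the free algebra. It descends to an algebra
automorphism of `U_ε^M(𝔤)`. Here `x ^ (r) = x ^ r / [r]!` is a divided power, and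
`p.1 + p.2 = - ⟨α_j, α_i^∨⟩`. -/
def braid (ε : ℂ) (b : P.Base) (M : IsogenyLattice P) (i : b.support) :
    Free b M →ₐ[ℂ] Free b M :=
  FreeAlgebra.lift ℂ fun g => match g with
    | Gen.E j =>
        if j = i then -(fF b M i * fK b M (M.root i))
        else ∑ p ∈ Finset.HasAntidiagonal.antidiagonal (-P.pairingIn ℤ (j : ι) (i : ι)).toNat,
          ((-1) ^ p.1 * (qRoot P ε i)⁻¹ ^ p.2 *
            (qFactorial (qRoot P ε i) p.1)⁻¹ * (qFactorial (qRoot P ε i) p.2)⁻¹) •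
              (fE b M i ^ p.1 * fE b M j * fE b M i ^ p.2)
    | Gen.F j =>
        if j = i then -(fK b M (-M.root i) * fE b M i)
        else ∑ p ∈ Finset.HasAntidiagonal.antidiagonal (-P.pairingIn ℤ (j : ι) (i : ι)).toNat,
          ((-1) ^ p.1 * (qRoot P ε i) ^ p.2 *
            (qFactorial (qRoot P ε i) p.1)⁻¹ * (qFactorial (qRoot P ε i) p.2)⁻¹) •
              (fF b M i ^ p.2 * fF b M j * fF b M i ^ p.1)
    | Gen.K μ => fK b M (M.reflect i μ)

/-- The root vector `E_{β_k} = T_{i_1} ⋯ T_{i_{k-1}} (E_{i_k})`. -/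
def rootE (ε : ℂ) (b : P.Base) (M : IsogenyLattice P) (w : List b.support) (k : Fin w.length) :
    U ε b M :=
  toU ε b M ((w.take k).foldr (fun i x => braid ε b M i x) (fE b M (w.get k)))

/-- The root vector `F_{β_k} = T_{i_1} ⋯ T_{i_{k-1}} (F_{i_k})`. -/
def rootF (ε : ℂ) (b : P.Base) (M : IsogenyLattice P) (w : List b.support) (k : Fin w.length) :
    U ε b M :=
  toU ε b M ((w.take k).foldr (fun i x => braid ε b M i x) (fF b M (w.get k)))

/-! ### The `ℓ`-center and the reduced algebras -/

/-- The `ℓ`-center `Z_0^M(𝔤)`: the subalgebra generated by the `ℓ`-th powers of the root vectors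
and of the `K_μ`. -/
def Z0 (ε : ℂ) (ℓ : ℕ) (b : P.Base) (M : IsogenyLattice P) (w : List b.support) :
    Subalgebra ℂ (U ε b M) :=
  Algebra.adjoin ℂ
    ((Set.range fun k => rootE ε b M w k ^ ℓ) ∪ (Set.range fun k => rootF ε b M w k ^ ℓ) ∪
      (Set.range fun μ => uK ε b M μ ^ ℓ))

section Z0

variable (ε : ℂ) (ℓ : ℕ) (b : P.Base) (M : IsogenyLattice P) (w : List b.support)

/-- `E_{β_k} ^ ℓ`, as an element of the `ℓ`-center. -/
def zE (k : Fin w.length) : Z0 ε ℓ b M w :=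
  ⟨rootE ε b M w k ^ ℓ, Algebra.subset_adjoin (Or.inl (Or.inl ⟨k, rfl⟩))⟩

/-- `F_{β_k} ^ ℓ`, as an element of the `ℓ`-center. -/
def zF (k : Fin w.length) : Z0 ε ℓ b M w :=
  ⟨rootF ε b M w k ^ ℓ, Algebra.subset_adjoin (Or.inl (Or.inr ⟨k, rfl⟩))⟩

/-- `μ ↦ K_μ ^ ℓ`, as a homomorphism from `M` to the `ℓ`-center. -/
def zK : Multiplicative M.lattice →* Z0 ε ℓ b M w where
  toFun μ := ⟨uK ε b M μ.toAdd ^ ℓ, Algebra.subset_adjoin (Or.inr ⟨μ.toAdd, rfl⟩)⟩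
  map_one' := by
    apply Subtype.ext
    simp [uK_zero]
  map_mul' μ ν := by
    apply Subtype.ext
    have h : Commute (uK ε b M μ.toAdd) (uK ε b M ν.toAdd) := by
      unfold Commute SemiconjBy
      rw [← uK_add, ← uK_add, add_comm]
    simp only [toAdd_mul, uK_add, h.mul_pow]
    rfl

end Z0

section Characters

variable {ε : ℂ} {ℓ : ℕ} {b : P.Base} {M : IsogenyLattice P} {w : List b.support}

/-- The torus component `μ ↦ η (K_μ ^ ℓ)` of an `ℓ`-character, in `T_M = Hom(M, ℂˣ)`. -/
def torusPart (η : Z0 ε ℓ b M w →ₐ[ℂ] ℂ) : Multiplicative M.lattice →* ℂˣ :=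
  ((η : Z0 ε ℓ b M w →* ℂ).comp (zK ε ℓ b M w)).toHomUnits

/-- The reduced quantized enveloping algebra `U_η^M(𝔤)`: the quotient of `U_ε^M(𝔤)` by the two-sided
ideal generated by the kernel of `η` (which is `(ker η) U_ε^M(𝔤)`, the `ℓ`-center being central). -/
abbrev Ured (η : Z0 ε ℓ b M w →ₐ[ℂ] ℂ) :=
  RingQuot fun x y : U ε b M => (∃ c : Z0 ε ℓ b M w, η c = 0 ∧ x = c) ∧ y = 0

end Characters

/-! ### The group `G_M` and the map `π_M` -/

variable {𝔤 : Type*} [LieRing 𝔤] [LieAlgebra ℂ 𝔤] [FiniteDimensional ℂ 𝔤]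
  [LieAlgebra.IsKilling ℂ 𝔤]

/-- The exponential of a complex matrix, as an invertible matrix. -/
def expGL {κ : Type*} [Fintype κ] [DecidableEq κ] (A : Matrix κ κ ℂ) : GL κ ℂ :=
  (Matrix.isUnit_exp A).unit

/-- A finite-dimensional representation of `𝔤`, written in a basis of weight vectors, whose weights
generate the lattice `M`. The group `G_M` is realised by means of such a representation. -/
structure Realization (H : LieSubalgebra ℂ 𝔤) [H.IsCartanSubalgebra]
    (M : IsogenyLattice (LieAlgebra.IsKilling.rootSystem H))
    (κ : Type*) [Fintype κ] [DecidableEq κ] where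
  rho : 𝔤 →ₗ[ℂ] Matrix κ κ ℂ
  rho_lie : ∀ x y : 𝔤, rho ⁅x, y⁆ = rho x * rho y - rho y * rho x
  wt : κ → weightLattice (LieAlgebra.IsKilling.rootSystem H)
  rho_cartan : ∀ h : H, rho h = Matrix.diagonal fun k => (wt k : Dual ℂ H) h
  closure_wt : AddSubgroup.closure (Set.range wt) = M.lattice

section Group

variable {H : LieSubalgebra ℂ 𝔤} [H.IsCartanSubalgebra]
  {M : IsogenyLattice (LieAlgebra.IsKilling.rootSystem H)}
  {κ : Type*} [Fintype κ] [DecidableEq κ]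

/-- A weight of the representation, as an element of `M`. -/
def Realization.weight (R : Realization H M κ) (k : κ) : M.lattice :=
  ⟨R.wt k, by rw [← R.closure_wt]; exact AddSubgroup.subset_closure ⟨k, rfl⟩⟩

/-- The action of `t ∈ T_M = Hom(M, ℂˣ)`: a vector of weight `μ` is multiplied by `t μ`. -/
def Realization.torus (R : Realization H M κ) (t : Multiplicative M.lattice →* ℂˣ) : GL κ ℂ :=
  Units.map (Matrix.diagonalRingHom κ ℂ : (κ → ℂ) →* Matrix κ κ ℂ)
    (MulEquiv.piUnits.symm fun k => t (Multiplicative.ofAdd (R.weight k)))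

/-- The complex semisimple group `G_M` with Lie algebra `𝔤` and isogeny type `M`, as a Chevalley
group: it is generated by the maximal torus `T_M` and by the root subgroups. -/
def Realization.group (R : Realization H M κ) : Subgroup (GL κ ℂ) :=
  Subgroup.closure
    (Set.range R.torus ∪
      {g | ∃ α : H.root, ∃ x ∈ LieAlgebra.rootSpace H α.1, g = expGL (R.rho x)})

/-- The weight of `𝔤` given by the `k`-th positive root `β_k` of a word. -/
def rootOf {b : (LieAlgebra.IsKilling.rootSystem H).Base} (w : List b.support)
    (k : Fin w.length) : LieModule.Weight ℂ H 𝔤 :=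
  (wordRoot w k : H.root).1

theorem neg_rootOf_mem {b : (LieAlgebra.IsKilling.rootSystem H).Base} (w : List b.support)
    (k : Fin w.length) : -rootOf w k ∈ H.root := by
  have h : rootOf w k ∈ H.root := (wordRoot w k).2
  simpa using h

/-- A choice of nonzero root vectors of `𝔤` for the positive roots `β_k` of a word and for their
negatives, i.e. of isomorphisms between `ℂ` and the corresponding root subgroups. -/
structure RootVectors {b : (LieAlgebra.IsKilling.rootSystem H).Base} (w : List b.support) where
  e : Fin w.length → 𝔤
  f : Fin w.length → 𝔤
  e_mem : ∀ k, e k ∈ LieAlgebra.rootSpace H (rootOf w k)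
  f_mem : ∀ k, f k ∈ LieAlgebra.rootSpace H (-rootOf w k : LieModule.Weight ℂ H 𝔤)
  e_ne_zero : ∀ k, e k ≠ 0
  f_ne_zero : ∀ k, f k ≠ 0

theorem Realization.torus_mem (R : Realization H M κ) (t : Multiplicative M.lattice →* ℂˣ) :
    R.torus t ∈ R.group :=
  Subgroup.subset_closure (Or.inl ⟨t, rfl⟩)

theorem Realization.exp_mem (R : Realization H M κ) {α : LieModule.Weight ℂ H 𝔤}
    (hα : α ∈ H.root) {x : 𝔤} (hx : x ∈ LieAlgebra.rootSpace H α) :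
    expGL (R.rho x) ∈ R.group :=
  Subgroup.subset_closure (Or.inr ⟨⟨α, hα⟩, x, hx, rfl⟩)

section PiMap

variable {b : (LieAlgebra.IsKilling.rootSystem H).Base} {w : List b.support} {ε : ℂ} {ℓ : ℕ}

/-- The component `v ∈ U` of an `ℓ`-character: `x_{β_1} (η (E_{β_1} ^ ℓ)) ⋯ x_{β_r} (η (E_{β_r} ^ ℓ))`,
where `x_{β_k} s = exp (s e_{β_k})`. -/
def upperPart (R : Realization H M κ) (X : RootVectors w) (η : Z0 ε ℓ b M w →ₐ[ℂ] ℂ) : R.group :=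
  (List.ofFn fun k => (⟨expGL (R.rho (η (zE ε ℓ b M w k) • X.e k)),
    R.exp_mem (wordRoot w k).2 (Submodule.smul_mem _ _ (X.e_mem k))⟩ : R.group)).prod

/-- The component `u ∈ U⁻` of an `ℓ`-character: the product of the
`x_{-β_k} (η (F_{β_k} ^ ℓ))`, where `x_{-β_k} s = exp (s f_{β_k})`, for decreasing `k`. -/
def lowerPart (R : Realization H M κ) (X : RootVectors w) (η : Z0 ε ℓ b M w →ₐ[ℂ] ℂ) : R.group :=
  (List.ofFn fun k => (⟨expGL (R.rho (η (zF ε ℓ b M w k) • X.f k)),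
    R.exp_mem (neg_rootOf_mem w k)
      (Submodule.smul_mem _ _ (X.f_mem k))⟩ : R.group)).reverse.prod

/-- The component `t ∈ T_M` of an `ℓ`-character. -/
def middlePart (R : Realization H M κ) (η : Z0 ε ℓ b M w →ₐ[ℂ] ℂ) : R.group :=
  ⟨R.torus (torusPart η), R.torus_mem _⟩

/-- The map `π_M`: an `ℓ`-character with components `u ∈ U⁻`, `t ∈ T_M`, `v ∈ U` corresponds to the
pair `(t⁻¹ u, t v)` in `B⁻ × B`, and it is mapped to `(t⁻¹ u)⁻¹ (t v)` in the group `G_M`. -/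
def piMap (R : Realization H M κ) (X : RootVectors w) (η : Z0 ε ℓ b M w →ₐ[ℂ] ℂ) : R.group :=
  ((middlePart R η)⁻¹ * lowerPart R X η)⁻¹ * (middlePart R η * upperPart R X η)

end PiMap

end Group

end QEA

end

noncomputable section

open scoped Matrix

/-! ### Distances in trees. -/

namespace SimpleGraph.IsTree

variable {V : Type*} {G : SimpleGraph V}

/-! Write `π_M(η) = u⁻¹t²v = z`, that is `uz = t²v`. A central `z` commutes with the torus, so it
preserves weights and has degree zero for the height, while `u - 1` lowers and `v - 1` raises the
height. Comparing degrees gives `u = v = 1` and `z = t²`. The roots `β_k` of a reduced word are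
distinct, so a trivial `u` or `v` has all coordinates zero: `η` kills every `E_γ^ℓ` and `F_γ^ℓ`
(`piMap_central`).

In a one-dimensional representation `K_α E_α = ε_α² E_α K_α` with `ε_α² ≠ 1` forces `E_α = 0`, and
then `K_α² = 1`. Such representations of `U_η` therefore amount to characters `χ` of `M` with `χ^ℓ =
t` and `χ²` trivial on `Q` (`exists_oneDim_iff`). For the converse, sending `E` and `F` to zero is
compatible with the braid operators, so all root vectors go to zero.

Since `z` is central, `t²` is trivial on `Q`, hence is a character of `M/Q`. A solution `χ` gives
`t² = (χ²)^ℓ`, so `(t²)^(m/d) = 1`. Conversely, if `t² = y^ℓ` with `y` a character of `M/Q` and `ℓ =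
2k+1`, then `χ = y^(-k) t` is a solution. Such a `y` exists when `(t²)^(m/d) = 1`, provided the
`ℓ`-primary part of `M/Q` is cyclic (`exists_root_character_iff`). As the weights of the realization
generate `M`, the condition `(t²)^(m/d) = 1` says that the order of `z` divides `m/d`.

Cyclicity follows from a bound on the Cartan matrix modulo an odd prime `p` (`p ≠ 3` for `G₂`): its
kernel is at most a line. The argument avoids the classification. The Dynkin diagram is a tree
without a node carrying three arms of length two, and a kernel vector vanishing at an end of a
longest path vanishes everywhere (`exists_forall_eq_zero`). -/

lemma eq_of_adj_of_dist_lt (hG : G.IsTree) (r : V) {v w₁ w₂ : V}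
    (h₁ : G.Adj v w₁) (h₂ : G.Adj v w₂)
    (hd₁ : G.dist r w₁ < G.dist r v) (hd₂ : G.dist r w₂ < G.dist r v) : w₁ = w₂ := by
  classical
  have key : ∀ w, G.Adj v w → G.dist r w < G.dist r v →
      ∃ (p : G.Walk r w) (h : G.Adj w v), (p.concat h).IsPath := by
    intro w hw hd
    obtain ⟨p, hp, hl⟩ := hG.connected.exists_path_of_dist r w
    refine ⟨p, hw.symm, hp.concat (fun hv => ?_) hw.symm⟩
    have := (SimpleGraph.dist_le (p.takeUntil v hv)).trans (p.length_takeUntil_le_length hv)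
    omega
  obtain ⟨p₁, a₁, hp₁⟩ := key w₁ h₁ hd₁
  obtain ⟨p₂, a₂, hp₂⟩ := key w₂ h₂ hd₂
  have := (hG.existsUnique_path r v).unique hp₁ hp₂
  have h := congrArg Walk.penultimate this
  simpa using h

end SimpleGraph.IsTree

/-! ### Positive definite matrices supported on a tree. -/

namespace Matrix

variable {n : Type*} [Fintype n]

/-- The graph on the index set of a matrix in which distinct `i`, `j` are joined if the
`(i, j)` or `(j, i)` entry is nonzero. -/
def supportGraph {R : Type*} [Zero R] (A : Matrix n n R) : SimpleGraph n :=
  SimpleGraph.fromRel fun i j => A i j ≠ 0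

/-- A real symmetric positive definite matrix with ones on the diagonal whose off-diagonal entries
are zero or at most `-1/2`, as obtained by normalising a Cartan matrix of finite type. -/
structure IsDynkin (S : Matrix n n ℝ) : Prop where
  diag : ∀ i, S i i = 1
  symm : ∀ i j, S i j = S j i
  off : ∀ i j, i ≠ j → S i j = 0 ∨ S i j ≤ -1 / 2
  pos : ∀ c : n → ℝ, c ≠ 0 → 0 < ∑ i, ∑ j, c i * c j * S i j

namespace IsDynkin

variable {S : Matrix n n ℝ}

lemma off_nonpos (hS : S.IsDynkin) {i j : n} (h : i ≠ j) : S i j ≤ 0 := by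
  rcases hS.off i j h with h | h <;> linarith

lemma adj_iff (hS : S.IsDynkin) {i j : n} : S.supportGraph.Adj i j ↔ i ≠ j ∧ S i j ≠ 0 := by
  simp [supportGraph, SimpleGraph.fromRel_adj, hS.symm j i]

lemma le_of_adj (hS : S.IsDynkin) {i j : n} (h : S.supportGraph.Adj i j) : S i j ≤ -1 / 2 := by
  rw [hS.adj_iff] at h
  exact (hS.off i j h.1).resolve_left h.2

/-- On the all-ones vector the diagonal contributes the number of nodes and each edge at most `-1`,
so positivity leaves fewer edges than nodes. -/
lemma isTree [Nonempty n] (hS : S.IsDynkin) (hc : S.supportGraph.Connected) :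
    S.supportGraph.IsTree := by
  classical
  refine SimpleGraph.isTree_iff_connected_and_card.mpr ⟨hc, le_antisymm ?_
    hc.card_vert_le_card_edgeSet_add_one⟩
  have h1 := hS.pos (fun _ => 1) (fun h => one_ne_zero (congrFun h (Classical.arbitrary n)))
  have h2 : ∀ i, ∑ j, (1 : ℝ) * 1 * S i j ≤ 1 - (S.supportGraph.degree i : ℝ) / 2 := by
    intro i
    have : ∀ j, (1 : ℝ) * 1 * S i j ≤
        (if j = i then 1 else 0) - (if S.supportGraph.Adj i j then 1 else 0) / 2 := by
      intro j
      by_cases hj : j = i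
      · subst hj; simp [hS.diag]
      · by_cases ha : S.supportGraph.Adj i j
        · have := hS.le_of_adj ha
          simp [hj, ha]; linarith
        · have := hS.off_nonpos (Ne.symm hj)
          simp [hj, ha, this]
    refine (Finset.sum_le_sum fun j _ => this j).trans_eq ?_
    rw [Finset.sum_sub_distrib, ← Finset.sum_div, Finset.sum_boole]
    simp [SimpleGraph.degree, SimpleGraph.neighborFinset_eq_filter]
    exact Finset.card_eq_one.mpr ⟨i, by ext; simp⟩
  have h3 := h1.trans_le (Finset.sum_le_sum fun i _ => h2 i)
  rw [Finset.sum_sub_distrib, ← Finset.sum_div, ← Nat.cast_sum,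
    SimpleGraph.sum_degrees_eq_twice_card_edges] at h3
  simp only [Finset.sum_const, Finset.card_univ, nsmul_eq_mul, mul_one, Nat.cast_mul,
    Nat.cast_ofNat] at h3
  have h4 : (S.supportGraph.edgeFinset.card : ℝ) < Fintype.card n := by linarith
  have h5 : S.supportGraph.edgeFinset.card < Fintype.card n := by exact_mod_cast h4
  rw [Nat.card_eq_fintype_card, Nat.card_eq_fintype_card, ← SimpleGraph.edgeFinset_card]
  omega

/-- The affine diagram of type `E₆` is the only forbidden subdiagram needed besides cycles. -/
lemma not_star_of_arms (hS : S.IsDynkin) (f : Fin 7 → n) (hf : Function.Injective f)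
    (h01 : S.supportGraph.Adj (f 0) (f 1)) (h02 : S.supportGraph.Adj (f 0) (f 2))
    (h03 : S.supportGraph.Adj (f 0) (f 3)) (h14 : S.supportGraph.Adj (f 1) (f 4))
    (h25 : S.supportGraph.Adj (f 2) (f 5)) (h36 : S.supportGraph.Adj (f 3) (f 6)) : False := by
  classical
  -- The marks of affine `E₆`: the squares sum to `24`, the six edges contribute at most `-24`, and
  -- any other off-diagonal entry is nonpositive.
  let a : Fin 7 → ℝ := ![3, 2, 2, 2, 1, 1, 1]
  let c : n → ℝ := fun i => ∑ k, if f k = i then a k else 0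
  have hsum : ∀ g : n → ℝ, ∑ i, c i * g i = ∑ k, a k * g (f k) := by
    intro g
    simp only [c, Finset.sum_mul]
    rw [Finset.sum_comm]
    refine Finset.sum_congr rfl fun k _ => ?_
    simp [ite_mul]
  have hc : c ≠ 0 := by
    intro h
    have h0 := congrFun h (f 0)
    have : c (f 0) = ∑ k, if k = 0 then a k else 0 :=
      Finset.sum_congr rfl fun k _ => by simp [hf.eq_iff]
    rw [this] at h0
    simp [a] at h0
  have hp := hS.pos c hc
  have e : ∑ i, ∑ j, c i * c j * S i j = ∑ k, a k * ∑ l, a l * S (f k) (f l) := by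
    rw [← hsum fun i => ∑ l, a l * S i (f l)]
    refine Finset.sum_congr rfl fun i _ => ?_
    rw [← hsum fun j => S i j, Finset.mul_sum]
    exact Finset.sum_congr rfl fun j _ => by ring
  rw [e] at hp
  have n' : ∀ k l, k ≠ l → S (f k) (f l) ≤ 0 := fun k l h => hS.off_nonpos (hf.ne h)
  have s' : ∀ k l, S (f k) (f l) = S (f l) (f k) := fun k l => hS.symm _ _
  simp only [Fin.sum_univ_seven, a, Matrix.cons_val, hS.diag] at hp
  rw [s' 1 0, s' 2 0, s' 3 0, s' 4 0, s' 5 0, s' 6 0, s' 2 1, s' 3 1, s' 4 1, s' 5 1, s' 6 1,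
    s' 3 2, s' 4 2, s' 5 2, s' 6 2, s' 4 3, s' 5 3, s' 6 3, s' 5 4, s' 6 4, s' 6 5] at hp
  linarith [hS.le_of_adj h01, hS.le_of_adj h02, hS.le_of_adj h03, hS.le_of_adj h14,
    hS.le_of_adj h25, hS.le_of_adj h36, n' 0 4 (by decide), n' 0 5 (by decide),
    n' 0 6 (by decide), n' 1 2 (by decide), n' 1 3 (by decide), n' 1 5 (by decide),
    n' 1 6 (by decide), n' 2 3 (by decide), n' 2 4 (by decide), n' 2 6 (by decide),
    n' 3 4 (by decide), n' 3 5 (by decide), n' 4 5 (by decide), n' 4 6 (by decide),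
    n' 5 6 (by decide)]

/-- The kernel of a matrix supported on a Dynkin diagram, with invertible entries at the nodes
and at the edges, is at most one-dimensional: some coordinate is injective on it. -/
lemma exists_forall_eq_zero [Nonempty n] (hS : S.IsDynkin) (hc : S.supportGraph.Connected)
    {K : Type*} [Field K] (A : Matrix n n K) (hd : ∀ i, A i i ≠ 0)
    (hA : ∀ i j, i ≠ j → (A i j ≠ 0 ↔ S.supportGraph.Adj i j)) :
    ∃ i, ∀ x : n → K, A *ᵥ x = 0 → x i = 0 → x = 0 := by
  classical
  set G := S.supportGraph with hGdef
  have hT : G.IsTree := hS.isTree hc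
  -- The coordinate is taken at an end `i` of a longest path, whose other end is `e`.
  obtain ⟨⟨i, e⟩, hmax⟩ := Finite.exists_max fun q : n × n => G.dist q.2 q.1
  replace hmax : ∀ a c, G.dist c a ≤ G.dist e i := fun a c => hmax (a, c)
  refine ⟨i, fun x hx hxi => ?_⟩
  by_contra hx0
  obtain ⟨s₀, hs₀⟩ := Function.ne_iff.mp hx0
  obtain ⟨s, hs, hmin⟩ := (Finset.univ.filter fun s => x s ≠ 0).exists_min_image
    (fun s => G.dist i s) ⟨s₀, by simpa using hs₀⟩
  simp only [Finset.mem_filter, Finset.mem_univ, true_and] at hs hmin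
  -- a neighbour of a node whose row relation has another nonzero term
  have row : ∀ v a, A v a * x a ≠ 0 → ∃ c, c ≠ a ∧ A v c * x c ≠ 0 := by
    intro v a ha
    by_contra! hcon
    have h := congrFun hx v
    rw [Matrix.mulVec, dotProduct, Finset.sum_eq_single a (fun c _ hca => hcon c hca)
      (by simp)] at h
    exact ha h
  have pm : ∀ r {v w}, G.Adj v w → G.dist r v = G.dist r w + 1 ∨ G.dist r w = G.dist r v + 1 :=
    fun r _ _ h => hT.dist_eq_dist_add_one_of_adj r h
  have hpos : ∀ a, x a ≠ 0 → a ≠ i := by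
    rintro a ha rfl; exact ha hxi
  have pred : ∀ a, a ≠ i → ∃ v, G.Adj a v ∧ G.dist i a = G.dist i v + 1 := by
    intro a ha
    obtain ⟨p, hp⟩ := hc.exists_walk_length_eq_dist a i
    cases p with
    | nil => exact absurd rfl ha
    | cons h q =>
      rename_i v
      refine ⟨v, h, ?_⟩
      have h1 := SimpleGraph.dist_le q
      rw [SimpleGraph.Walk.length_cons] at hp
      rw [SimpleGraph.dist_comm (u := i), SimpleGraph.dist_comm (u := i)]
      have := pm i h
      rw [SimpleGraph.dist_comm (u := i), SimpleGraph.dist_comm (u := i)] at this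
      omega
  have small : ∀ a, G.dist i a < G.dist i s → x a = 0 := by
    intro a ha
    by_contra h
    exact absurd (hmin a h) (by omega)
  -- The support node `s` is nearest to `i`, so `x` vanishes at the node `v` preceding it. The row
  -- of `v` then needs a second support neighbour `s'`, and `v` branches.
  obtain ⟨v, hsv, hdv⟩ := pred s (hpos s hs)
  have hvs : A v s ≠ 0 := (hA v s hsv.ne').mpr hsv.symm
  obtain ⟨s', hs's, hs'⟩ := row v s (mul_ne_zero hvs hs)
  have hxv : x v = 0 := small v (by omega)
  have hvs' : G.Adj v s' := by
    refine (hA v s' ?_).mp (left_ne_zero_of_mul hs')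
    rintro rfl; exact hs' (by rw [hxv, mul_zero])
  have hds' : G.dist i s' = G.dist i v + 1 := by
    have h1 := hmin s' (right_ne_zero_of_mul hs')
    have := pm i hvs'
    omega
  -- extend the arm through `a`
  have arm : ∀ a, x a ≠ 0 → G.Adj v a → G.dist i a = G.dist i v + 1 →
      ∃ t, G.Adj a t ∧ t ≠ v ∧ G.dist i t = G.dist i v + 2 := by
    intro a ha hva hda
    obtain ⟨t, hta, ht⟩ := row a a (mul_ne_zero (hd a) ha)
    have hat : G.Adj a t := (hA a t hta.symm).mp (left_ne_zero_of_mul ht)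
    have htv : t ≠ v := by
      rintro rfl; exact ht (by rw [hxv, mul_zero])
    refine ⟨t, hat, htv, ?_⟩
    rcases pm i hat with h | h
    · exact absurd (hT.eq_of_adj_of_dist_lt i hat hva.symm (by omega) (by omega)) htv
    · omega
  obtain ⟨t, hst, htv, hdt⟩ := arm s hs hsv.symm hdv
  obtain ⟨t', hst', htv', hdt'⟩ := arm s' (right_ne_zero_of_mul hs') hvs' hds'
  have hii : G.dist i i = 0 := SimpleGraph.dist_self
  -- of two neighbours of a node, one is further away from `e`
  have far : ∀ v a c, G.Adj v a → G.Adj v c → a ≠ c →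
      G.dist e a = G.dist e v + 1 ∨ G.dist e c = G.dist e v + 1 := by
    intro v a c ha hc' hac
    by_contra! hcon
    have h1 := pm e ha
    have h2 := pm e hc'
    exact hac (hT.eq_of_adj_of_dist_lt e ha hc' (by omega) (by omega))
  -- If `v` is `i` or a neighbour of `i`, one of the branches through `s`, `s'` leads further from
  -- `e` than `i` is, against maximality. Otherwise the arm from `v` towards `i` also has length at
  -- least two.
  by_cases hvi : v = i
  · subst hvi
    have h1 := hmax s e
    have h2 := hmax s' e
    rcases far v s s' hsv.symm hvs' hs's.symm with h | h <;> omega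
  obtain ⟨u, hvu, hdu⟩ := pred v hvi
  by_cases hui : u = i
  · subst hui
    have hu : G.dist e u = G.dist e v + 1 := by
      have h1 := hmax v e
      have := pm e hvu
      omega
    have fin : ∀ a c, G.Adj v a → G.Adj a c → c ≠ v → G.dist e a = G.dist e v + 1 → False := by
      intro a c hva hac hcv hda
      have h1 := hmax c e
      have h2 := pm e hac
      exact hcv (hT.eq_of_adj_of_dist_lt e hac hva.symm (by omega) (by omega))
    rcases far v s s' hsv.symm hvs' hs's.symm with h | h
    · exact fin s t hsv.symm hst htv h
    · exact fin s' t' hvs' hst' htv' h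
  obtain ⟨u', huu', hdu'⟩ := pred u hui
  have htt' : t ≠ t' := by
    rintro rfl
    exact hs's (hT.eq_of_adj_of_dist_lt i hst'.symm hst.symm (by omega) (by omega))
  have hne : ∀ {a c}, G.dist i a ≠ G.dist i c → a ≠ c := by
    rintro a c h rfl; exact h rfl
  refine hS.not_star_of_arms ![v, u, s, s', u', t, t'] ?_ hvu hsv.symm hvs' huu' hst hst'
  intro k l hkl
  by_contra hne'
  -- The distance from `i` separates these nodes, except for the pairs `s, s'` and `t, t'`.
  have key : ∀ k l : Fin 7, k < l →
      (![v, u, s, s', u', t, t'] : Fin 7 → n) k ≠ ![v, u, s, s', u', t, t'] l := by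
    intro k l
    fin_cases k <;> fin_cases l <;> intro hlt <;>
      first
      | exact absurd hlt (by decide)
      | exact hs's.symm
      | exact htt'
      | (refine hne ?_; simp; omega)
  rcases lt_or_gt_of_ne hne' with h | h
  · exact key k l h hkl
  · exact key l k h hkl.symm

end IsDynkin

end Matrix

namespace QEA

open Module Matrix

variable {ι V N : Type*} [AddCommGroup V] [Module ℂ V] [AddCommGroup N] [Module ℂ N]
  {P : RootPairing ι ℂ V N} [P.IsCrystallographic] [Fintype ι]

/-! ### The Dynkin diagram of a base -/

/-- The canonical invariant form on pairs of roots. -/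
def gram (P : RootPairing ι ℂ V N) [P.IsCrystallographic] (i j : ι) : ℤ :=
  ∑ k, P.pairingIn ℤ i k * P.pairingIn ℤ j k

lemma gram_comm (i j : ι) : gram P i j = gram P j i :=
  Finset.sum_congr rfl fun _ _ => mul_comm _ _

lemma gram_cast (i j : ι) : (gram P i j : ℂ) = P.RootForm (P.root i) (P.root j) := by
  simp only [gram, Int.cast_sum, Int.cast_mul, P.rootForm_apply_apply]
  refine Finset.sum_congr rfl fun k _ => ?_
  rw [P.root_coroot'_eq_pairing, P.root_coroot'_eq_pairing, ← P.algebraMap_pairingIn ℤ,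
    ← P.algebraMap_pairingIn ℤ]
  rfl

lemma gram_self_pos (i : ι) : 0 < gram P i i :=
  Finset.sum_pos' (fun k _ => mul_self_nonneg _) ⟨i, Finset.mem_univ i, by simp⟩

lemma two_mul_gram (i j : ι) : 2 * gram P i j = P.pairingIn ℤ i j * gram P j j := by
  have h := P.toInvariantForm.two_mul_apply_root_root i j
  change 2 * P.RootForm _ _ = _ * P.RootForm _ _ at h
  rw [← gram_cast, ← gram_cast, ← P.algebraMap_pairingIn ℤ] at h
  simp only [algebraMap_int_eq, eq_intCast] at h
  exact_mod_cast h

/-- The Gram matrix of the simple roots, normalised to have ones on the diagonal. -/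
def dynkinMatrix (b : P.Base) : Matrix b.support b.support ℝ :=
  .of fun i j => (gram P i j : ℝ) / (√(gram P i i : ℝ) * √(gram P j j : ℝ))

lemma sqrt_gram_pos (i : ι) : 0 < √(gram P i i : ℝ) :=
  Real.sqrt_pos.mpr (by exact_mod_cast gram_self_pos i)

lemma sqrt_gram_mul_self (i : ι) : √(gram P i i : ℝ) * √(gram P i i : ℝ) = gram P i i :=
  Real.mul_self_sqrt (by exact_mod_cast (gram_self_pos i).le)

section

variable [P.IsRootSystem]

lemma eq_zero_of_sum_pairingIn_eq_zero {K : Type*} [Field K] [CharZero K] {b : P.Base}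
    (c : b.support → K)
    (h : ∀ k : b.support, ∑ i : b.support, c i * (P.pairingIn ℤ i k : K) = 0) : c = 0 := by
  classical
  have hdet : ((b.cartanMatrix).map (Int.castRingHom K)).det ≠ 0 := by
    rw [← RingHom.mapMatrix_apply, ← RingHom.map_det]
    have := Matrix.nondegenerate_iff_det_ne_zero.mp b.cartanMatrix_nondegenerate
    simpa using this
  refine Matrix.eq_zero_of_vecMul_eq_zero hdet ?_
  funext k
  simpa [Matrix.vecMul, dotProduct, RootPairing.Base.cartanMatrixIn_def] using h k

lemma isDynkin_dynkinMatrix (b : P.Base) : (dynkinMatrix b).IsDynkin where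
  diag i := by
    have := sqrt_gram_mul_self (P := P) (i : ι)
    have h := sqrt_gram_pos (P := P) (i : ι)
    simp only [dynkinMatrix, of_apply, this]
    exact div_self (by exact_mod_cast (gram_self_pos (i : ι)).ne')
  symm i j := by simp only [dynkinMatrix, of_apply, gram_comm (i : ι) j, mul_comm]
  off i j hij := by
    have h1 := two_mul_gram (P := P) (i : ι) j
    have h2 := two_mul_gram (P := P) (j : ι) i
    rw [gram_comm] at h2
    have hle : P.pairingIn ℤ i j ≤ 0 := b.cartanMatrix_le_zero_of_ne i j hij
    have hle' : P.pairingIn ℤ j i ≤ 0 := b.cartanMatrix_le_zero_of_ne j i hij.symm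
    have hi := gram_self_pos (P := P) (i : ι)
    have hj := gram_self_pos (P := P) (j : ι)
    by_cases h0 : P.pairingIn ℤ i j = 0
    · left
      have : gram P i j = 0 := by rw [h0] at h1; linarith
      simp [dynkinMatrix, this]
    · right
      have h0' : P.pairingIn ℤ j i ≠ 0 := by
        intro h
        rw [h] at h2
        have h3 : gram P i j = 0 := by linarith
        rw [h3, mul_zero] at h1
        exact (mul_ne_zero h0 hj.ne') h1.symm
      -- Both Cartan integers are at most `-1`, so twice the product is at most minus either squared
      -- length, hence at most minus their geometric mean.
      have a1 : 2 * gram P i j ≤ -gram P j j := by nlinarith [lt_of_le_of_ne hle h0]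
      have a2 : 2 * gram P i j ≤ -gram P i i := by nlinarith [lt_of_le_of_ne hle' h0']
      have a1' : 2 * (gram P i j : ℝ) ≤ -gram P j j := by exact_mod_cast a1
      have a2' : 2 * (gram P i j : ℝ) ≤ -gram P i i := by exact_mod_cast a2
      have s1 := sqrt_gram_pos (P := P) (i : ι)
      have s2 := sqrt_gram_pos (P := P) (j : ι)
      simp only [dynkinMatrix, of_apply]
      rw [div_le_iff₀ (by positivity)]
      nlinarith [sqrt_gram_mul_self (P := P) (i : ι), sqrt_gram_mul_self (P := P) (j : ι),
        sq_nonneg (√(gram P i i : ℝ) - √(gram P j j : ℝ))]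
  pos c hc := by
    set c' : b.support → ℝ := fun i => c i / √(gram P i i : ℝ) with hc'
    -- The form is a sum of squares over all coroots; it vanishes only if the pairings with the
    -- simple coroots do, which the nondegenerate Cartan matrix excludes.
    have e : ∑ i, ∑ j, c i * c j * dynkinMatrix b i j =
        ∑ k, (∑ i, c' i * (P.pairingIn ℤ i k : ℝ)) ^ 2 := by
      simp only [sq, Finset.sum_mul_sum]
      rw [Finset.sum_comm]
      conv_rhs => rw [Finset.sum_comm]
      rw [Finset.sum_comm]
      refine Finset.sum_congr rfl fun i _ => ?_
      rw [Finset.sum_comm]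
      refine Finset.sum_congr rfl fun j _ => ?_
      have s1 := sqrt_gram_pos (P := P) (i : ι)
      have s2 := sqrt_gram_pos (P := P) (j : ι)
      have : ∀ k, c' i * (P.pairingIn ℤ i k : ℝ) * (c' j * (P.pairingIn ℤ j k : ℝ)) =
          (c' i * c' j) * (P.pairingIn ℤ i k * P.pairingIn ℤ j k : ℤ) := by
        intro k; push_cast; ring
      rw [Finset.sum_congr rfl fun k _ => this k, ← Finset.mul_sum, ← Int.cast_sum]
      change c i * c j * ((gram P i j : ℝ) / _) = c' i * c' j * (gram P i j : ℝ)
      simp only [hc']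
      field_simp
    rw [e]
    refine lt_of_le_of_ne (Finset.sum_nonneg fun k _ => sq_nonneg _) fun h => hc ?_
    rw [eq_comm, Finset.sum_eq_zero_iff_of_nonneg fun k _ => sq_nonneg _] at h
    have h0 := eq_zero_of_sum_pairingIn_eq_zero (b := b) c'
      fun k => pow_eq_zero_iff two_ne_zero |>.mp (h k (Finset.mem_univ _))
    funext i
    have := congrFun h0 i
    simp only [hc', Pi.zero_apply, div_eq_zero_iff, (sqrt_gram_pos (P := P) (i : ι)).ne',
      or_false] at this
    exact this

lemma adj_dynkinMatrix_iff (b : P.Base) {i j : b.support} :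
    (dynkinMatrix b).supportGraph.Adj i j ↔ i ≠ j ∧ P.pairingIn ℤ i j ≠ 0 := by
  rw [(isDynkin_dynkinMatrix b).adj_iff]
  refine and_congr_right fun _ => not_congr ?_
  have h1 := two_mul_gram (P := P) (i : ι) j
  have hj := gram_self_pos (P := P) (j : ι)
  have s1 := sqrt_gram_pos (P := P) (i : ι)
  have s2 := sqrt_gram_pos (P := P) (j : ι)
  simp only [dynkinMatrix, of_apply, div_eq_zero_iff, (mul_pos s1 s2).ne', or_false,
    Int.cast_eq_zero]
  constructor
  · intro h
    rw [h, mul_zero, eq_comm, mul_eq_zero] at h1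
    exact h1.resolve_right hj.ne'
  · intro h
    rw [h] at h1; linarith

variable [P.IsReduced] [P.IsIrreducible]

lemma connected_dynkinMatrix (b : P.Base) [Nonempty b.support] :
    (dynkinMatrix b).supportGraph.Connected := by
  refine ⟨fun i j => ?_⟩
  refine b.induction_on_cartanMatrix (fun k => (dynkinMatrix b).supportGraph.Reachable i k)
    (SimpleGraph.Reachable.refl i) fun k l hk hl => ?_
  by_cases hkl : l = k
  · rwa [hkl]
  · exact hk.trans ((adj_dynkinMatrix_iff b).mpr ⟨hkl, hl⟩).symm.reachable

/-- Modulo an odd prime (different from `3` for `G₂`), the Cartan matrix has corank at most one. -/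
lemma exists_forall_eq_zero_of_cartanMatrix (b : P.Base) [Nonempty b.support] (p : ℕ)
    [Fact p.Prime] (h2 : p ≠ 2) (h3 : P.IsG2 → p ≠ 3) :
    ∃ i : b.support, ∀ x : b.support → ZMod p,
      (∀ j : b.support, ∑ i, x i * (P.pairingIn ℤ i j : ZMod p) = 0) → x i = 0 → x = 0 := by
  have hprime : p.Prime := Fact.out
  -- Nonzero Cartan integers have absolute value at most `3`, and `3` occurs only for `G₂`.
  -- Reduction modulo `p` therefore preserves the support of the Cartan matrix.
  have hcast : ∀ k : ℕ, 0 < k → k ≤ 3 → (k = 3 → p ≠ 3) → (k : ZMod p) ≠ 0 := by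
    intro k hk hk3 h h0
    rw [ZMod.natCast_eq_zero_iff] at h0
    have := Nat.le_of_dvd hk h0
    have := hprime.two_le
    have : p = 3 := by omega
    have : k = 3 := by omega
    exact h this ‹_›
  have hd : ∀ i : b.support, (.of fun j i : b.support => (P.pairingIn ℤ i j : ZMod p) :
      Matrix b.support b.support (ZMod p)) i i ≠ 0 := by
    intro i
    simpa using hcast 2 (by norm_num) (by norm_num) (by norm_num)
  have hA : ∀ i j : b.support, i ≠ j → ((.of fun j i : b.support => (P.pairingIn ℤ i j : ZMod p) :
      Matrix b.support b.support (ZMod p)) i j ≠ 0 ↔ (dynkinMatrix b).supportGraph.Adj i j) := by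
    intro i j hij
    rw [SimpleGraph.adj_comm, adj_dynkinMatrix_iff]
    simp only [of_apply, hij.symm, ne_eq, not_false_eq_true, true_and]
    refine not_congr ⟨fun h => ?_, fun h => by simp [h]⟩
    have := b.cartanMatrix_mem_of_ne hij.symm
    simp only [RootPairing.Base.cartanMatrixIn_def, Set.mem_insert_iff,
      Set.mem_singleton_iff] at this
    rcases this with h' | h' | h' | h'
    · rw [h'] at h
      refine absurd ?_ (hcast 3 (by norm_num) le_rfl fun _ => h3 ?_)
      · simpa using h
      · exact { exists_pairingIn_neg_three := ⟨_, _, h'⟩ }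
    · rw [h'] at h
      refine absurd ?_ (hcast 2 (by norm_num) (by norm_num) (by norm_num))
      simpa using h
    · rw [h'] at h
      simp at h
    · exact h'
  obtain ⟨i, hi⟩ := (isDynkin_dynkinMatrix b).exists_forall_eq_zero (connected_dynkinMatrix b)
    _ hd hA
  refine ⟨i, fun x hx => hi x ?_⟩
  funext j
  simpa [Matrix.mulVec, dotProduct, mul_comm] using hx j

end

/-! ### Weights modulo roots -/

omit [Fintype ι] [P.IsCrystallographic] in
lemma wtPairing_eq_of {μ : weightLattice P} {i : ι} {k : ℤ}
    (h : P.toLinearMap (μ : V) (P.coroot i) = k) : wtPairing μ i = k := by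
  rw [wtPairing_spec] at h
  exact_mod_cast h

variable (P) in
/-- The pairing with a coroot, as an additive map on weights. -/
def wtPairingHom (i : ι) : weightLattice P →+ ℤ where
  toFun μ := wtPairing μ i
  map_zero' := wtPairing_eq_of (by simp)
  map_add' μ ν := wtPairing_eq_of (by simp [wtPairing_spec])

omit [Fintype ι] in
lemma wtPairing_rootWeight (i j : ι) : wtPairing (rootWeight P i) j = P.pairingIn ℤ i j :=
  wtPairing_eq_of (by
    rw [rootWeight, P.root_coroot_eq_pairing, ← P.algebraMap_pairingIn ℤ]
    rfl)

omit [Fintype ι] in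
lemma exists_eq_sum_rootWeight (b : P.Base) {μ : weightLattice P} (h : μ ∈ rootLattice P) :
    ∃ c : b.support → ℤ, μ = ∑ i, c i • rootWeight P (i : ι) := by
  induction h using AddSubgroup.closure_induction with
  | mem x hx =>
    obtain ⟨i, rfl⟩ := hx
    obtain ⟨f, -, -, hf⟩ := b.exists_root_eq_sum_int i
    refine ⟨fun i => f i, Subtype.ext ?_⟩
    rw [AddSubgroup.val_finsetSum]
    change P.root i = ∑ j : b.support, f j • P.root j
    rw [hf, ← Finset.sum_coe_sort]
  | zero => exact ⟨0, by simp⟩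
  | add x y _ _ hx hy =>
    obtain ⟨c, rfl⟩ := hx
    obtain ⟨d, rfl⟩ := hy
    exact ⟨c + d, by simp [add_smul, Finset.sum_add_distrib]⟩
  | neg x _ hx =>
    obtain ⟨c, rfl⟩ := hx
    exact ⟨-c, by simp⟩

omit [Fintype ι] in
lemma sum_rootWeight_mem (b : P.Base) (c : b.support → ℤ) :
    ∑ i, c i • rootWeight P (i : ι) ∈ rootLattice P :=
  sum_mem fun i _ => zsmul_mem (AddSubgroup.subset_closure (Set.mem_range_self (i : ι))) _

omit [Fintype ι] in
lemma wtPairing_sum (b : P.Base) (c : b.support → ℤ) (j : ι) :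
    wtPairing (∑ i, c i • rootWeight P (i : ι)) j = ∑ i, c i * P.pairingIn ℤ i j := by
  change wtPairingHom P j _ = _
  rw [map_sum]
  refine Finset.sum_congr rfl fun i _ => ?_
  rw [map_zsmul, smul_eq_mul]
  exact congrArg _ (wtPairing_rootWeight _ _)

omit [Fintype ι] [P.IsCrystallographic] in
lemma wtPairing_zsmul (k : ℤ) (μ : weightLattice P) (j : ι) :
    wtPairing (k • μ) j = k * wtPairing μ j :=
  (map_zsmul (wtPairingHom P j) k μ).trans (by rw [smul_eq_mul]; rfl)

variable [P.IsRootSystem]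

omit [Fintype ι] [P.IsCrystallographic] in
lemma weight_ext (b : P.Base) {μ ν : weightLattice P}
    (h : ∀ j : b.support, wtPairing μ j = wtPairing ν j) : μ = ν := by
  refine Subtype.ext (P.toPerfPair.injective (b.toCoweightBasis.ext fun j => ?_))
  change P.toLinearMap _ _ = P.toLinearMap _ _
  rw [RootPairing.Base.toCoweightBasis_apply, wtPairing_spec, wtPairing_spec, h]

/-- The determinant of the Cartan matrix serves as multiplier: by Cramer's rule its adjugate gives
the coordinates in the simple roots. -/
lemma exists_zsmul_mem_rootLattice (b : P.Base) :
    ∃ k : ℤ, k ≠ 0 ∧ ∀ μ : weightLattice P, k • μ ∈ rootLattice P := by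
  classical
  refine ⟨b.cartanMatrix.det,
    Matrix.nondegenerate_iff_det_ne_zero.mp b.cartanMatrix_nondegenerate, fun μ => ?_⟩
  have : b.cartanMatrix.det • μ =
      ∑ i, ((fun j : b.support => wtPairing μ j) ᵥ* b.cartanMatrix.adjugate) i •
        rootWeight P (i : ι) := by
    refine weight_ext b fun j => ?_
    rw [wtPairing_zsmul, wtPairing_sum]
    change _ = (((fun j : b.support => wtPairing μ j) ᵥ* b.cartanMatrix.adjugate) ᵥ*
      b.cartanMatrix) j
    rw [Matrix.vecMul_vecMul, Matrix.adjugate_mul, Matrix.vecMul_smul, Matrix.vecMul_one]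
    simp
  rw [this]
  exact sum_rootWeight_mem b _

omit [P.IsCrystallographic] in
lemma finite_weightLattice (b : P.Base) : Module.Finite ℤ (weightLattice P) := by
  let f : weightLattice P →+ (b.support → ℤ) := AddMonoidHom.mk' (fun μ j => wtPairing μ j)
    fun μ ν => funext fun j => map_add (wtPairingHom P j) μ ν
  exact Module.Finite.of_injective f.toIntLinearMap fun μ ν h =>
    weight_ext b fun j => congrFun h j

/-- The quotient of a lattice of weights by the root lattice. -/
abbrev IsogenyLattice.quot (M : IsogenyLattice P) : Type _ :=
  M.lattice ⧸ (rootLattice P).addSubgroupOf M.lattice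

lemma IsogenyLattice.finite_quot (M : IsogenyLattice P) (b : P.Base) : Finite M.quot := by
  obtain ⟨k, hk0, hk⟩ := exists_zsmul_mem_rootLattice b
  have := finite_weightLattice b
  have h1 : Module.Finite ℤ (AddSubgroup.toIntSubmodule M.lattice) := inferInstance
  have h2 : Module.Finite ℤ M.lattice := h1
  have h3 : AddGroup.FG M.quot := by
    have h4 : AddGroup.FG M.lattice := Module.Finite.iff_addGroup_fg.mp h2
    exact QuotientAddGroup.fg _
  refine AddCommGroup.finite_of_fg_isAddTorsion _ fun x => ?_
  rw [isOfFinAddOrder_iff_zsmul_eq_zero]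
  refine ⟨k, hk0, ?_⟩
  induction x using QuotientAddGroup.induction_on with
  | H z =>
    rw [← QuotientAddGroup.mk_zsmul, QuotientAddGroup.eq_zero_iff, AddSubgroup.mem_addSubgroupOf]
    exact hk z

variable [P.IsReduced] [P.IsIrreducible]

/-- For an odd prime `p`, different from `3` for `G₂`, the `p`-torsion of `M / Q` has at most
`p` elements. -/
lemma IsogenyLattice.card_torsion_le (M : IsogenyLattice P) (b : P.Base) [Nonempty b.support]
    (p : ℕ) [Fact p.Prime] (h2 : p ≠ 2) (h3 : P.IsG2 → p ≠ 3) :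
    Nat.card {x : M.quot // p • x = 0} ≤ p := by
  obtain ⟨i, hi⟩ := exists_forall_eq_zero_of_cartanMatrix b p h2 h3
  have key : ∀ μ : M.lattice, (p • (μ : M.quot) = 0) →
      ∃ c : b.support → ℤ, p • (μ : weightLattice P) = ∑ i, c i • rootWeight P (i : ι) := by
    intro μ h
    rw [← QuotientAddGroup.mk_nsmul, QuotientAddGroup.eq_zero_iff,
      AddSubgroup.mem_addSubgroupOf] at h
    exact exists_eq_sum_rootWeight b h
  have key' : ∀ x : {x : M.quot // p • x = 0}, ∃ (μ : M.lattice) (c : b.support → ℤ),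
      (μ : M.quot) = x ∧ p • (μ : weightLattice P) = ∑ i, c i • rootWeight P (i : ι) := by
    rintro ⟨x, hx⟩
    obtain ⟨μ, rfl⟩ := QuotientAddGroup.mk_surjective x
    obtain ⟨c, hc⟩ := key μ hx
    exact ⟨μ, c, rfl, hc⟩
  choose μ c hμ hc using key'
  -- If `pμ = ∑ c_i α_i`, pairing with the simple coroots puts `c` modulo `p` in the kernel of the
  -- Cartan matrix, where one coordinate determines the vector.
  have hinj : Function.Injective fun x => (c x i : ZMod p) := by
    intro x y hxy
    have hx0 : (fun k => ((c x k - c y k : ℤ) : ZMod p)) = 0 := by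
      refine hi _ (fun j => ?_) (by simpa [sub_eq_zero] using hxy)
      have e : p * wtPairing ((μ x - μ y : M.lattice) : weightLattice P) j =
          ∑ k : b.support, (c x k - c y k) * P.pairingIn ℤ k j := by
        have := wtPairing_sum b (c x - c y) j
        simp only [Pi.sub_apply, sub_smul, Finset.sum_sub_distrib, ← hc] at this
        rw [← this, ← smul_sub, ← natCast_zsmul, wtPairing_zsmul]
        rfl
      have e' := congrArg (Int.cast : ℤ → ZMod p) e
      push_cast at e' ⊢
      rw [← e']
      simp
    have hdvd : ∀ k, ∃ d, c x k - c y k = p * d := by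
      intro k
      exact (ZMod.intCast_zmod_eq_zero_iff_dvd _ p).mp (congrFun hx0 k)
    choose d hd using hdvd
    -- Coefficients divisible by `p` can be divided by `p`, which puts the difference of the two
    -- weights in `Q`.
    have e : ((μ x - μ y : M.lattice) : weightLattice P) = ∑ k, d k • rootWeight P (k : ι) := by
      refine weight_ext b fun j => ?_
      have hp : (p : ℤ) ≠ 0 := by exact_mod_cast (Fact.out : p.Prime).ne_zero
      refine mul_left_cancel₀ hp ?_
      rw [wtPairing_sum, Finset.mul_sum]
      have := wtPairing_sum b (c x - c y) j
      simp only [Pi.sub_apply, sub_smul, Finset.sum_sub_distrib, ← hc] at this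
      rw [← wtPairing_zsmul]
      have e2 : (p : ℤ) • ((μ x - μ y : M.lattice) : weightLattice P) =
        p • (μ x : weightLattice P) - p • (μ y : weightLattice P) := by
        rw [natCast_zsmul, ← smul_sub]; rfl
      rw [e2, this]
      exact Finset.sum_congr rfl fun k _ => by rw [hd]; ring
    refine Subtype.ext ?_
    rw [← hμ x, ← hμ y, ← sub_eq_zero, ← QuotientAddGroup.mk_sub, QuotientAddGroup.eq_zero_iff,
      AddSubgroup.mem_addSubgroupOf, e]
    exact sum_rootWeight_mem b d
  calc _ ≤ Nat.card (ZMod p) := Nat.card_le_card_of_injective _ hinj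
    _ = p := Nat.card_zmod p

end QEA

namespace QEA

/-! ### Powers in finite abelian groups -/

section Powers

variable {A : Type*} [CommGroup A] [Finite A]

/-- The nonempty fibres of `x ↦ x ^ p` are cosets of the `p`-torsion. -/
lemma card_pow_eq_one_mul_le {p n a : ℕ} (hp : Nat.card {x : A // x ^ p = 1} ≤ n) :
    Nat.card {x : A // x ^ (p * a) = 1} ≤ n * Nat.card {x : A // x ^ a = 1} := by
  classical
  have := Fintype.ofFinite A
  rw [Nat.card_eq_fintype_card, Fintype.card_subtype] at hp ⊢
  rw [Nat.card_eq_fintype_card, Fintype.card_subtype]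
  refine Finset.card_le_mul_card_image_of_maps_to (f := fun x => x ^ p) ?_ n ?_
  · intro x hx
    simpa [pow_mul] using hx
  · intro y _
    rcases Finset.eq_empty_or_nonempty
      ((Finset.univ.filter fun x : A => x ^ (p * a) = 1).filter fun x => x ^ p = y) with h | ⟨x₀, h₀⟩
    · simp [h]
    · refine le_trans (Finset.card_le_card_of_injOn (fun x => x / x₀) ?_
        (div_left_injective.injOn)) hp
      intro x hx
      simp only [Finset.coe_filter, Finset.mem_filter, Finset.mem_univ, true_and,
        Set.mem_ofPred_eq] at hx h₀ ⊢
      rw [div_pow, hx.2, h₀.2, div_self']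

lemma card_pow_eq_one_le {ℓ : ℕ} (h : ∀ p : ℕ, p.Prime → p ∣ ℓ → Nat.card {x : A // x ^ p = 1} ≤ p)
    (k : ℕ) {n : ℕ} (hn : n ∣ ℓ ^ k) (hn0 : n ≠ 0) : Nat.card {x : A // x ^ n = 1} ≤ n := by
  induction n using induction_on_primes with
  | zero => exact absurd rfl hn0
  | one => simp
  | prime_mul p a hp ih =>
    have hpl : p ∣ ℓ := hp.dvd_of_dvd_pow ((dvd_mul_right p a).trans hn)
    exact (card_pow_eq_one_mul_le (h p hp hpl)).trans
      (Nat.mul_le_mul_left p (ih ((dvd_mul_left a p).trans hn) (right_ne_zero_of_mul hn0)))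

lemma exists_coprime_factorization (ℓ m : ℕ) (hm : m ≠ 0) :
    ∃ m₁ m₂ k, m = m₁ * m₂ ∧ m₁ ∣ ℓ ^ k ∧ Nat.Coprime ℓ m₂ := by
  induction m using Nat.strong_induction_on with
  | _ m ih =>
    by_cases hg : Nat.gcd ℓ m = 1
    · exact ⟨1, m, 0, by simp, by simp, hg⟩
    · obtain ⟨c, hc⟩ := Nat.gcd_dvd_right ℓ m
      have hg0 : Nat.gcd ℓ m ≠ 0 := fun h => hm (by rw [hc, h, zero_mul])
      have hc0 : c ≠ 0 := by rintro rfl; exact hm hc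
      obtain ⟨m₁, m₂, k, h1, h2, h3⟩ := ih c (by
        rw [hc]
        exact lt_mul_of_one_lt_left (Nat.pos_of_ne_zero hc0) (by omega)) hc0
      refine ⟨Nat.gcd ℓ m * m₁, m₂, k + 1, by rw [mul_assoc, ← h1, ← hc], ?_, h3⟩
      rw [pow_succ']
      exact mul_dvd_mul (Nat.gcd_dvd_left ℓ m) h2

lemma exists_pow_eq_of_coprime {G : Type*} [Group G] {ℓ n : ℕ} (h : Nat.Coprime ℓ n) {x : G}
    (hx : x ^ n = 1) : ∃ y, y ^ ℓ = x ∧ y ∈ Subgroup.zpowers x := by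
  refine ⟨x ^ (Nat.gcdA ℓ n), ?_, ⟨_, rfl⟩⟩
  have e := Nat.gcd_eq_gcd_ab ℓ n
  rw [h] at e
  calc (x ^ (Nat.gcdA ℓ n)) ^ ℓ = x ^ ((ℓ : ℤ) * Nat.gcdA ℓ n) * (x ^ n) ^ (Nat.gcdB ℓ n) := by
        rw [hx, one_zpow, mul_one, ← zpow_natCast, ← zpow_mul, mul_comm]
    _ = x ^ ((ℓ : ℤ) * Nat.gcdA ℓ n + n * Nat.gcdB ℓ n) := by
        rw [zpow_add, ← zpow_natCast, ← zpow_mul]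
    _ = x := by rw [← e]; simp

/-- If the `ℓ`-primary part of a finite abelian group of order `m` is cyclic, then its `ℓ`-th powers
are the elements killed by `m / gcd ℓ m`. -/
lemma exists_pow_eq_of_pow_div_gcd {ℓ : ℕ} (hℓ : ℓ ≠ 0)
    (h : ∀ p : ℕ, p.Prime → p ∣ ℓ → Nat.card {x : A // x ^ p = 1} ≤ p) {z : A}
    (hz : z ^ (Nat.card A / Nat.gcd ℓ (Nat.card A)) = 1) : ∃ y, y ^ ℓ = z := by
  classical
  obtain ⟨m₁, m₂, k, hm, hk, hcop⟩ := exists_coprime_factorization ℓ (Nat.card A) Nat.card_pos.ne'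
  have hm0 : m₁ * m₂ ≠ 0 := hm ▸ Nat.card_pos.ne'
  have hm₁ : m₁ ≠ 0 := left_ne_zero_of_mul hm0
  have hcop' : Nat.Coprime m₁ m₂ := (hcop.pow_left k).coprime_dvd_left hk
  set d := Nat.gcd ℓ m₁ with hd
  have hd' : Nat.gcd ℓ (m₁ * m₂) = d := Nat.Coprime.gcd_mul_right_cancel_right m₁ hcop.symm
  obtain ⟨c, hc⟩ : d ∣ m₁ := Nat.gcd_dvd_right ℓ m₁
  have hd0 : 0 < d := Nat.gcd_pos_of_pos_left _ (Nat.pos_of_ne_zero hℓ)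
  rw [hm, hd', hc, mul_assoc, Nat.mul_div_cancel_left _ hd0] at hz
  -- the `m₁`-torsion subgroup is cyclic of order `m₁`
  let H : Subgroup A := (powMonoidHom m₁ : A →* A).ker
  have hH : ∀ x : A, x ∈ H ↔ x ^ m₁ = 1 := fun x => Iff.rfl
  -- A finite group with at most `n` solutions of `x ^ n = 1` for each `n > 0` is cyclic. Inside `H`
  -- the exponent may be replaced by `gcd n m₁`, whose prime factors divide `ℓ`.
  have hcyc : IsCyclic H := by
    have := Fintype.ofFinite H
    refine isCyclic_of_card_pow_eq_one_le fun n hn => ?_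
    have hg : Nat.gcd n m₁ ∣ ℓ ^ k := (Nat.gcd_dvd_right _ _).trans hk
    have hg0 : Nat.gcd n m₁ ≠ 0 := (Nat.gcd_pos_of_pos_left _ hn).ne'
    refine le_trans ?_ ((card_pow_eq_one_le h k hg hg0).trans
      (Nat.le_of_dvd hn (Nat.gcd_dvd_left _ _)))
    rw [← Fintype.card_subtype, ← Nat.card_eq_fintype_card]
    refine Nat.card_le_card_of_injective
      (fun x => ⟨(x.1 : A), pow_gcd_eq_one.mpr
        ⟨by exact_mod_cast congrArg Subtype.val x.2, (hH _).mp x.1.2⟩⟩) ?_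
    intro x y hxy
    have h1 : (x.1 : A) = y.1 := by simpa using hxy
    exact Subtype.ext (Subtype.ext h1)
  -- The image of `x ↦ x ^ m₁` is killed by `m₂`, so by Cauchy's theorem its order is prime to `m₁`.
  have hcardH : m₁ ∣ Nat.card H := by
    have e : Nat.card H * Nat.card (powMonoidHom m₁ : A →* A).range = m₁ * m₂ := by
      rw [← hm, ← Subgroup.index_ker, Subgroup.card_mul_index]
    refine Nat.Coprime.dvd_of_dvd_mul_right ?_ (Dvd.intro _ e.symm)
    refine Nat.Coprime.symm (Nat.coprime_of_dvd fun q hq hq1 hq2 => ?_)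
    have := Fact.mk hq
    obtain ⟨x, hxo⟩ := exists_prime_orderOf_dvd_card' q hq1
    obtain ⟨y, hy⟩ := MonoidHom.mem_range.mp x.2
    rw [← Subgroup.orderOf_coe, ← hy] at hxo
    have h1 : q ∣ m₂ := by
      rw [← hxo]
      refine orderOf_dvd_of_pow_eq_one ?_
      rw [powMonoidHom_apply, ← pow_mul, ← hm]
      exact pow_card_eq_one'
    exact hq.one_lt.ne' (Nat.dvd_one.mp (hcop' ▸ Nat.dvd_gcd hq2 h1))
  obtain ⟨⟨g, hgH⟩, hg⟩ := hcyc.exists_generator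
  have hgo : orderOf g = m₁ := by
    refine Nat.dvd_antisymm (orderOf_dvd_of_pow_eq_one ((hH g).mp hgH)) (hcardH.trans ?_)
    rw [← Subgroup.orderOf_mk g hgH, orderOf_eq_card_of_forall_mem_zpowers hg]
  -- split `z`
  have e := Nat.gcd_eq_gcd_ab m₁ m₂
  rw [hcop', Nat.cast_one] at e
  obtain ⟨y₂, hy₂, -⟩ := exists_pow_eq_of_coprime (x := z ^ ((m₁ : ℤ) * Nat.gcdA m₁ m₂)) hcop (by
    rw [← zpow_natCast, ← zpow_mul, mul_right_comm, ← Nat.cast_mul, zpow_mul, zpow_natCast, ← hm,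
      pow_card_eq_one', one_zpow])
  have hz1 : z ^ ((m₂ : ℤ) * Nat.gcdB m₁ m₂) ∈ H := by
    rw [hH, ← zpow_natCast, ← zpow_mul, mul_right_comm, ← Nat.cast_mul, zpow_mul, zpow_natCast,
      mul_comm m₂, ← hm, pow_card_eq_one', one_zpow]
  obtain ⟨j, hj⟩ := hg ⟨_, hz1⟩
  replace hj : g ^ j = z ^ ((m₂ : ℤ) * Nat.gcdB m₁ m₂) := congrArg Subtype.val hj
  -- The hypothesis on `z` gives `g ^ (j * c) = 1`, and `g` has order `d * c`. By Bézout `g ^ d` is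
  -- an `ℓ`-th power.
  have hdj : (d : ℤ) ∣ j := by
    have h1 : g ^ (j * c) = 1 := by
      rw [zpow_mul, hj, ← zpow_mul, mul_right_comm, ← Nat.cast_mul, zpow_mul, zpow_natCast,
        mul_comm m₂, hz, one_zpow]
    rw [← orderOf_dvd_iff_zpow_eq_one, hgo, hc, Nat.cast_mul] at h1
    have hc0 : (c : ℤ) ≠ 0 := by
      rintro h0
      exact hm₁ (by rw [hc]; exact_mod_cast (by rw [h0, mul_zero] : (d : ℤ) * c = 0))
    exact Int.dvd_of_mul_dvd_mul_right hc0 h1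
  obtain ⟨i, rfl⟩ := hdj
  refine ⟨(g ^ Nat.gcdA ℓ m₁) ^ i * y₂, ?_⟩
  have hgd : (g ^ Nat.gcdA ℓ m₁) ^ ℓ = g ^ d := by
    have e := Nat.gcd_eq_gcd_ab ℓ m₁
    calc (g ^ Nat.gcdA ℓ m₁) ^ ℓ = g ^ ((ℓ : ℤ) * Nat.gcdA ℓ m₁) * (g ^ m₁) ^ Nat.gcdB ℓ m₁ := by
          rw [(hH g).mp hgH, one_zpow, mul_one, ← zpow_natCast, ← zpow_mul, mul_comm]
      _ = g ^ ((ℓ : ℤ) * Nat.gcdA ℓ m₁ + m₁ * Nat.gcdB ℓ m₁) := by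
          rw [zpow_add, ← zpow_natCast, ← zpow_mul]
      _ = g ^ d := by rw [← e, zpow_natCast]
  rw [mul_pow, hy₂, ← zpow_natCast, zpow_comm, zpow_natCast, hgd, ← zpow_natCast,
    ← zpow_mul, hj, ← zpow_add, add_comm, ← e, zpow_one]

end Powers

/-! ### Characters of a lattice -/

/-- A character `t` whose square is trivial on a subgroup `Q` of finite index `m` has an `ℓ`-th root
with the same property if and only if `t ^ 2` is killed by `m / gcd ℓ m`. -/
lemma exists_root_character_iff {L : Type*} [AddCommGroup L] (Q : AddSubgroup L) [Finite (L ⧸ Q)]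
    {ℓ : ℕ} (hodd : Odd ℓ)
    (h : ∀ p : ℕ, p.Prime → p ∣ ℓ → Nat.card {x : L ⧸ Q // p • x = 0} ≤ p)
    (t : Multiplicative L →* ℂˣ) (ht : ∀ q ∈ Q, t (.ofAdd q) ^ 2 = 1) :
    (∃ χ : Multiplicative L →* ℂˣ, (∀ x, χ x ^ ℓ = t x) ∧ ∀ q ∈ Q, χ (.ofAdd q) ^ 2 = 1) ↔
      ∀ x, (t x ^ 2) ^ (Nat.card (L ⧸ Q) / Nat.gcd ℓ (Nat.card (L ⧸ Q))) = 1 := by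
  set m := Nat.card (L ⧸ Q) with hm
  have hℓ : ℓ ≠ 0 := hodd.pos.ne'
  constructor
  · rintro ⟨χ, hχt, hχ⟩ x
    have h1 : (χ x ^ 2) ^ m = 1 := by
      have hx : m • x.toAdd ∈ Q := by
        rw [← QuotientAddGroup.eq_zero_iff, QuotientAddGroup.mk_nsmul]
        exact card_nsmul_eq_zero'
      have := hχ _ hx
      rw [ofAdd_nsmul, ofAdd_toAdd, map_pow, ← pow_mul, mul_comm, pow_mul] at this
      exact this
    obtain ⟨c, hc⟩ := Nat.gcd_dvd_right ℓ m
    obtain ⟨a, ha⟩ := Nat.gcd_dvd_left ℓ m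
    have hd0 : 0 < Nat.gcd ℓ m := Nat.gcd_pos_of_pos_left _ hodd.pos
    have hdiv : m / Nat.gcd ℓ m = c := Nat.div_eq_of_eq_mul_right hd0 hc
    rw [hdiv, ← hχt, ← pow_mul, ← pow_mul]
    -- With `d = gcd ℓ m`, `ℓ = d * a` and `m = d * c`: the exponent is a multiple of `2 * m`, which
    -- kills `χ`.
    have : ℓ * (2 * c) = 2 * m * a := by
      conv_lhs => rw [ha]
      conv_rhs => rw [hc]
      ring
    rw [this, pow_mul, pow_mul, h1, one_pow]
  · intro hz
    -- A noncanonical isomorphism of the finite group with its dual suffices to carry the extraction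
    -- of roots over to characters.
    obtain ⟨φ⟩ : Nonempty ((Multiplicative (L ⧸ Q) →* ℂˣ) ≃* Multiplicative (L ⧸ Q)) :=
      CommGroup.monoidHom_mulEquiv_of_hasEnoughRootsOfUnity _ _
    let f : L →+ Additive ℂˣ := AddMonoidHom.mk' (fun x => .ofMul (t (.ofAdd x) ^ 2)) fun x y => by
      rw [ofAdd_add, map_mul, mul_pow, ofMul_mul]
    let g := QuotientAddGroup.lift Q f fun q hq => congrArg Additive.ofMul (ht q hq)
    let z : Multiplicative (L ⧸ Q) →* ℂˣ := MonoidHom.mk' (fun x => (g x.toAdd).toMul) fun x y => by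
      rw [toAdd_mul, map_add, toMul_add]
    have hz' : ∀ x : L, z (.ofAdd (x : L ⧸ Q)) = t (.ofAdd x) ^ 2 := fun x => rfl
    obtain ⟨y', hy'⟩ : ∃ y, y ^ ℓ = φ z := by
      refine exists_pow_eq_of_pow_div_gcd hℓ h ?_
      rw [← map_pow, ← map_one φ]
      refine congrArg φ (MonoidHom.ext fun x => ?_)
      refine (map_pow (MonoidHom.eval x) z _).trans ?_
      obtain ⟨v, hv⟩ := QuotientAddGroup.mk_surjective x.toAdd
      have hx : z x = t (.ofAdd v) ^ 2 := by rw [← hz' v, hv, ofAdd_toAdd]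
      change (z x) ^ _ = 1
      rw [hx]
      exact hz _
    let y := φ.symm y'
    have hy : ∀ x, y x ^ ℓ = z x := by
      intro x
      have : φ.symm (y' ^ ℓ) = z := by rw [hy', φ.symm_apply_apply]
      rw [← this]
      exact (map_pow ((MonoidHom.eval x).comp φ.symm.toMonoidHom) y' ℓ).symm
    obtain ⟨k, hk⟩ := hodd
    -- Since `y ^ ℓ = t ^ 2` and `ℓ = 2k + 1`, the `ℓ`-th power of `y ^ (-k) * t` is `t ^ (-2k + ℓ)
    -- = t`. On `Q` the factor `y` is trivial.
    let χ : Multiplicative L →* ℂˣ := MonoidHom.mk'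
      (fun x => y (.ofAdd (x.toAdd : L ⧸ Q)) ^ (-k : ℤ) * t x) fun a c => by
        rw [toAdd_mul, QuotientAddGroup.mk_add, ofAdd_add, map_mul, map_mul, mul_zpow,
          mul_mul_mul_comm]
    refine ⟨χ, fun x => ?_, fun q hq => ?_⟩
    · have h1 := (hy (.ofAdd (x.toAdd : L ⧸ Q))).trans (hz' x.toAdd)
      change (y (.ofAdd (x.toAdd : L ⧸ Q)) ^ (-k : ℤ) * t x) ^ ℓ = t x
      rw [mul_pow, ← zpow_natCast, zpow_comm, zpow_natCast, h1, ofAdd_toAdd, ← zpow_natCast,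
        ← zpow_natCast, ← zpow_mul, ← zpow_add]
      have : ((2 : ℕ) : ℤ) * -(k : ℤ) + (ℓ : ℤ) = 1 := by rw [hk]; push_cast; ring
      rw [this, zpow_one]
    · change (y (.ofAdd (q : L ⧸ Q)) ^ (-k : ℤ) * t (.ofAdd q)) ^ 2 = 1
      rw [mul_pow, ht q hq, (QuotientAddGroup.eq_zero_iff q).mpr hq, ofAdd_zero, map_one,
        one_zpow, one_pow, one_mul]

end QEA

namespace QEA

open Module

variable {ι V N : Type*} [AddCommGroup V] [Module ℂ V] [AddCommGroup N] [Module ℂ N]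
  {P : RootPairing ι ℂ V N} [P.IsCrystallographic] [Fintype ι]

/-! ### The parameters `ε_α` -/

omit [Fintype ι] in
lemma isG2_of_pairingIn_eq_three [P.IsReduced] [P.IsIrreducible] {i j : ι}
    (h : P.pairingIn ℤ i j = 3 ∨ P.pairingIn ℤ i j = -3) : P.IsG2 := by
  rcases h with h | h
  · exact { exists_pairingIn_neg_three := ⟨P.reflectionPerm i i, j, by simp [h]⟩ }
  · exact { exists_pairingIn_neg_three := ⟨i, j, h⟩ }

/-- Irreducibility provides a root of minimal length not orthogonal to the given one; the ratio of
squared lengths is then a ratio of two Cartan integers, and `3` forces type `G₂`. -/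
lemma halfNorm_eq [P.IsRootSystem] [P.IsReduced] [P.IsIrreducible] (i : ι) :
    halfNorm P i = 1 ∨ halfNorm P i = 2 ∨ (halfNorm P i = 3 ∧ P.IsG2) := by
  have hN := halfNorm_mul (P := P) i
  set B := P.posRootForm ℤ with hB
  obtain ⟨j, -, hj⟩ := Finset.exists_mem_eq_inf' (s := (Finset.univ : Finset ι))
    ⟨i, Finset.mem_univ i⟩ B.rootLength
  have hmin : B.rootLength j ≤ B.rootLength i := by
    rw [← hj]
    exact Finset.inf'_le _ (Finset.mem_univ i)
  obtain ⟨k, hk1, hk2⟩ := P.exists_form_eq_form_and_form_ne_zero B.toInvariantForm i j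
  have hkj : B.rootLength k = B.rootLength j := by
    have := hk1
    change B.form _ _ = B.form _ _ at this
    rw [← B.algebraMap_rootLength, ← B.algebraMap_rootLength] at this
    exact_mod_cast this
  have hp : P.pairingIn ℤ i k ≠ 0 := by
    intro h0
    have h1 := B.two_mul_apply_root_root (i := i) (j := k)
    rw [← P.algebraMap_pairingIn ℤ, h0] at h1
    apply hk2
    change B.form _ _ = 0
    simpa using h1
  have hsw := B.pairingIn_mul_eq_pairingIn_mul_swap k i
  have hmem := P.pairingIn_pairingIn_mem_set_of_isCrystal_of_isRed i k
  have hpos := B.rootLength_pos j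
  have hG := isG2_of_pairingIn_eq_three (P := P) (i := i) (j := k)
  rw [hj] at hN
  rw [hkj] at hsw
  have key : ∀ c : ℤ, B.rootLength i = c * B.rootLength j → halfNorm P i = c := fun c hc =>
    mul_right_cancel₀ hpos.ne' (hN.trans hc)
  simp only [Set.mem_insert_iff, Set.mem_singleton_iff, Prod.mk.injEq] at hmem
  rcases hmem with h | h | h | h | h | h | h | h | h | h | h | h | h <;> rw [h.1, h.2] at hsw
  · exact absurd h.1 hp
  all_goals first
    | exact Or.inl (key 1 (by lia))
    | exact Or.inr (Or.inl (key 2 (by lia)))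
    | exact Or.inr (Or.inr ⟨key 3 (by lia), hG (by rw [h.1]; decide)⟩)

lemma qRoot_sq_ne_one [P.IsRootSystem] [P.IsReduced] [P.IsIrreducible] {ℓ : ℕ} (hℓ : 1 < ℓ)
    (hodd : Odd ℓ) (hG2 : P.IsG2 → Nat.Coprime ℓ 3) {ε : ℂ} (hε : IsPrimitiveRoot ε ℓ) (i : ι) :
    qRoot P ε i ^ 2 ≠ 1 := by
  intro h
  have h' : ε ^ (halfNorm P i * 2) = 1 := by rw [zpow_mul]; exact_mod_cast h
  rw [hε.zpow_eq_one_iff_dvd] at h'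
  have hco : IsCoprime (ℓ : ℤ) 2 := by
    exact_mod_cast Nat.isCoprime_iff_coprime.mpr hodd.coprime_two_right
  have h1 := hco.dvd_of_dvd_mul_right h'
  have hcontra : ∀ {c : ℤ}, IsCoprime (ℓ : ℤ) c → ¬ (ℓ : ℤ) ∣ c := by
    intro c hc hd
    have := hc.isUnit_of_dvd' dvd_rfl hd
    rw [Int.isUnit_iff] at this
    omega
  rcases halfNorm_eq (P := P) i with h | h | ⟨h, hG⟩ <;> rw [h] at h1
  · exact hcontra isCoprime_one_right h1
  · exact hcontra hco h1
  · exact hcontra (by exact_mod_cast Nat.isCoprime_iff_coprime.mpr (hG2 hG)) h1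

/-! ### Characters of the free algebra killing the `E_α` and `F_α` -/

section

variable {ε : ℂ} {b : P.Base} {M : IsogenyLattice P}

/-- Each monomial in the image of an `E_j` or `F_j` under `T_i` still contains a factor `E` or `F`.
-/
lemma braid_kills {g : Free b M →ₐ[ℂ] ℂ} (hE : ∀ j, g (fE b M j) = 0) (hF : ∀ j, g (fF b M j) = 0)
    (i : b.support) :
    (∀ j, g (braid ε b M i (fE b M j)) = 0) ∧ ∀ j, g (braid ε b M i (fF b M j)) = 0 := by
  constructor <;> intro j
  · rw [show braid ε b M i (fE b M j) = _ from FreeAlgebra.lift_ι_apply _ _]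
    dsimp only
    by_cases h : j = i
    · simp [h, hF]
    · simp only [h, if_false, map_sum, map_smul, map_mul, hE, mul_zero, zero_mul, smul_zero,
        Finset.sum_const_zero]
  · rw [show braid ε b M i (fF b M j) = _ from FreeAlgebra.lift_ι_apply _ _]
    dsimp only
    by_cases h : j = i
    · simp [h, hE]
    · simp only [h, if_false, map_sum, map_smul, map_mul, hF, mul_zero, zero_mul, smul_zero,
        Finset.sum_const_zero]

/-- The induction replaces `g` by `g ∘ T_i`, hence the quantifier over `g`. No descent of `T_i` to
the quotient algebra is needed. -/
lemma foldr_braid_kills (u : List b.support) : ∀ {g : Free b M →ₐ[ℂ] ℂ},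
    (∀ j, g (fE b M j) = 0) → (∀ j, g (fF b M j) = 0) → ∀ j,
    g (u.foldr (fun i x => braid ε b M i x) (fE b M j)) = 0 ∧
      g (u.foldr (fun i x => braid ε b M i x) (fF b M j)) = 0 := by
  induction u with
  | nil => exact fun hE hF j => ⟨hE j, hF j⟩
  | cons i u ih =>
    intro g hE hF j
    have h := braid_kills (ε := ε) hE hF i
    exact ih (g := g.comp (braid ε b M i)) h.1 h.2 j

omit [Fintype ι] in
lemma character_sq_eq_one (χ : Multiplicative M.lattice →* ℂˣ)
    (h : ∀ i : b.support, χ (.ofAdd (M.root i)) ^ 2 = 1) :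
    ∀ q ∈ (rootLattice P).addSubgroupOf M.lattice, χ (.ofAdd q) ^ 2 = 1 := by
  intro q hq
  obtain ⟨c, hc⟩ := exists_eq_sum_rootWeight b (AddSubgroup.mem_addSubgroupOf.mp hq)
  have e : q = ∑ i : b.support, c i • M.root i := by
    refine Subtype.ext (hc.trans ?_)
    rw [AddSubgroup.val_finsetSum]
    rfl
  rw [e, ofAdd_sum, map_prod, ← Finset.prod_pow]
  refine Finset.prod_eq_one fun i _ => ?_
  rw [ofAdd_zsmul, map_zpow, ← zpow_natCast, zpow_comm, zpow_natCast, h i, one_zpow]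

end

/-! ### One-dimensional representations -/

section

variable {ε : ℂ} {ℓ : ℕ} {b : P.Base} {M : IsogenyLattice P} {w : List b.support}

/-- In the commutative target, `K_α E_α = ε_α² E_α K_α` with `K_α` invertible kills `E_α`; the
commutator relation of `E_α` and `F_α` then yields `K_α = K_α⁻¹`. -/
lemma exists_character_of_algHom (hq : ∀ i, qRoot P ε i ^ 2 ≠ 1) (hε : ε ≠ 0)
    (η : Z0 ε ℓ b M w →ₐ[ℂ] ℂ) (f : U ε b M →ₐ[ℂ] ℂ)
    (hf : ∀ c : Z0 ε ℓ b M w, η c = 0 → f c = 0) :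
    ∃ χ : Multiplicative M.lattice →* ℂˣ, (∀ x, χ x ^ ℓ = torusPart η x) ∧
      ∀ q ∈ (rootLattice P).addSubgroupOf M.lattice, χ (.ofAdd q) ^ 2 = 1 := by
  -- The element `c - η c` lies in the kernel of `η`.
  have hη : ∀ c : Z0 ε ℓ b M w, f c = η c := by
    intro c
    have h := hf (c - algebraMap ℂ _ (η c)) ((map_sub η _ _).trans (by
      rw [AlgHom.commutes]
      exact sub_self _))
    have h2 : ((c - algebraMap ℂ (Z0 ε ℓ b M w) (η c) : Z0 ε ℓ b M w) : U ε b M) =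
      (c : U ε b M) - algebraMap ℂ _ (η c) := rfl
    rw [h2, map_sub, AlgHom.commutes, sub_eq_zero] at h
    exact h
  have hrel : ∀ {x y : Free b M}, Rel ε b M x y → f (toU ε b M x) = f (toU ε b M y) := by
    intro x y h
    exact congrArg f (RingQuot.mkAlgHom_rel ℂ h)
  let k : Multiplicative M.lattice →* ℂ :=
    { toFun := fun μ => f (uK ε b M μ.toAdd)
      map_one' := by rw [toAdd_one, uK_zero, map_one]
      map_mul' := fun x y => by rw [toAdd_mul, uK_add, map_mul] }
  let χ := k.toHomUnits
  have hχ : ∀ μ : M.lattice, (χ (.ofAdd μ) : ℂ) = f (uK ε b M μ) := fun μ => rfl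
  have hk0 : ∀ μ : M.lattice, f (uK ε b M μ) ≠ 0 := fun μ => by
    rw [← hχ]; exact Units.ne_zero _
  have hform : ∀ i : b.support, ε ^ formRoot (M.root i : weightLattice P) i = qRoot P ε i ^ 2 := by
    intro i
    have : wtPairing (M.root i : weightLattice P) (i : ι) = 2 :=
      (wtPairing_rootWeight (P := P) (i : ι) i).trans (by simp)
    rw [formRoot, this, zpow_mul]
    rfl
  refine ⟨χ, fun x => ?_, character_sq_eq_one (b := b) χ fun i => ?_⟩
  · ext
    rw [Units.val_pow_eq_pow_val]
    change f (uK ε b M x.toAdd) ^ ℓ = η (zK ε ℓ b M w x)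
    rw [← hη, ← map_pow]
    rfl
  · have hE : f (toU ε b M (fE b M i)) = 0 := by
      have h := hrel (Rel.K_E (M.root i) i)
      rw [map_mul, map_mul, map_smul, map_smul, map_mul, map_mul, hform, smul_eq_mul] at h
      by_contra h0
      refine hq i (mul_right_cancel₀ (mul_ne_zero h0 (hk0 (M.root i))) ?_)
      rw [one_mul]
      exact h.symm.trans (mul_comm _ _)
    have h := hrel (Rel.E_F_self (ε := ε) (M := M) i)
    simp only [map_sub, map_mul, hE, zero_mul, mul_zero, sub_zero, map_smul, smul_eq_mul] at h
    have hne : (qRoot P ε i - (qRoot P ε i)⁻¹)⁻¹ ≠ 0 := by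
      refine inv_ne_zero fun h0 => hq i ?_
      have hz : qRoot P ε i ≠ 0 := zpow_ne_zero _ hε
      rw [sub_eq_zero] at h0
      rw [sq]
      nth_rewrite 2 [h0]
      exact mul_inv_cancel₀ hz
    have h1 := (mul_eq_zero.mp h.symm).resolve_left hne
    rw [sub_eq_zero] at h1
    have h2 : χ (.ofAdd (M.root i)) = (χ (.ofAdd (M.root i)))⁻¹ := by
      rw [← map_inv, ← ofAdd_neg]
      exact Units.ext h1
    rw [sq]
    nth_rewrite 2 [h2]
    exact mul_inv_cancel _

lemma exists_algHom_of_character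
    (η : Z0 ε ℓ b M w →ₐ[ℂ] ℂ) (hℓ : ℓ ≠ 0) (hE : ∀ k, η (zE ε ℓ b M w k) = 0)
    (hF : ∀ k, η (zF ε ℓ b M w k) = 0) (χ : Multiplicative M.lattice →* ℂˣ)
    (hχ : ∀ x, χ x ^ ℓ = torusPart η x)
    (hχ2 : ∀ q ∈ (rootLattice P).addSubgroupOf M.lattice, χ (.ofAdd q) ^ 2 = 1) :
    ∃ f : U ε b M →ₐ[ℂ] ℂ, ∀ c : Z0 ε ℓ b M w, f c = η c := by
  let g : Free b M →ₐ[ℂ] ℂ := FreeAlgebra.lift ℂ fun x => match x with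
    | Gen.E _ => 0
    | Gen.F _ => 0
    | Gen.K μ => χ (.ofAdd μ)
  have gE : ∀ j, g (fE b M j) = 0 := fun j => FreeAlgebra.lift_ι_apply _ _
  have gF : ∀ j, g (fF b M j) = 0 := fun j => FreeAlgebra.lift_ι_apply _ _
  have gK : ∀ μ, g (fK b M μ) = χ (.ofAdd μ) := fun j => FreeAlgebra.lift_ι_apply _ _
  have hg : ∀ ⦃x y⦄, Rel ε b M x y → g x = g y := by
    intro x y h
    cases h with
    | K_zero => simp [gK]
    | K_mul μ ν => simp [gK]
    | K_E μ i => simp [gE]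
    | K_F μ i => simp [gF]
    | E_F_self i =>
      have h1 : χ (.ofAdd (M.root i)) = χ (.ofAdd (-M.root i)) := by
        have := hχ2 (M.root i) (AddSubgroup.mem_addSubgroupOf.mpr
          (AddSubgroup.subset_closure (Set.mem_range_self (i : ι))))
        rw [ofAdd_neg, map_inv]
        exact eq_inv_of_mul_eq_one_left (by rw [← sq, this])
      simp only [map_sub, map_mul, map_smul, gE, gK, h1, zero_mul, mul_zero, sub_self, smul_zero]
    | E_F_ne i j h => simp [gE]
    | serre_E i j h =>
      simp only [map_sum, map_smul, map_mul, gE, mul_zero, zero_mul, smul_zero,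
        Finset.sum_const_zero, map_zero]
    | serre_F i j h =>
      simp only [map_sum, map_smul, map_mul, gF, mul_zero, zero_mul, smul_zero,
        Finset.sum_const_zero, map_zero]
  let f : U ε b M →ₐ[ℂ] ℂ := RingQuot.liftAlgHom ℂ ⟨g, hg⟩
  have hfg : ∀ x, f (toU ε b M x) = g x := fun x => RingQuot.liftAlgHom_mkAlgHom_apply ℂ g hg x
  refine ⟨f, fun c => ?_⟩
  obtain ⟨c, hc⟩ := c
  induction hc using Algebra.adjoin_induction with
  | mem x hx =>
    rcases hx with (⟨k, rfl⟩ | ⟨k, rfl⟩) | ⟨μ, rfl⟩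
    · refine Eq.trans ?_ (hE k).symm
      simp only [map_pow, rootE, hfg, (foldr_braid_kills (w.take k) gE gF (w.get k)).1]
      exact zero_pow hℓ
    · refine Eq.trans ?_ (hF k).symm
      simp only [map_pow, rootF, hfg, (foldr_braid_kills (w.take k) gE gF (w.get k)).2]
      exact zero_pow hℓ
    · have h := congrArg Units.val (hχ (.ofAdd μ))
      refine Eq.trans ?_ h
      simp only [map_pow, uK, hfg, gK, Units.val_pow_eq_pow_val]
  | algebraMap r =>
    exact (f.commutes r).trans (η.commutes r).symm
  | add x y hx hy h1 h2 =>
    have := map_add η ⟨x, hx⟩ ⟨y, hy⟩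
    rw [← h1, ← h2, ← map_add] at this
    exact this.symm
  | mul x y hx hy h1 h2 =>
    have := map_mul η ⟨x, hx⟩ ⟨y, hy⟩
    rw [← h1, ← h2, ← map_mul] at this
    exact this.symm

/-- If an `ℓ`-character `η` kills the `ℓ`-th powers of the root vectors, then the one-dimensional
representations of the reduced algebra correspond to the `ℓ`-th roots of its torus part whose
square is trivial on the root lattice. -/
lemma exists_oneDim_iff (hq : ∀ i, qRoot P ε i ^ 2 ≠ 1) (hε : ε ≠ 0) (hℓ : ℓ ≠ 0)
    (η : Z0 ε ℓ b M w →ₐ[ℂ] ℂ) (hE : ∀ k, η (zE ε ℓ b M w k) = 0)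
    (hF : ∀ k, η (zF ε ℓ b M w k) = 0) :
    (∃ (V : Type) (_ : AddCommGroup V) (_ : Module ℂ V) (_ : Ured η →ₐ[ℂ] Module.End ℂ V),
      Module.finrank ℂ V = 1) ↔
    ∃ χ : Multiplicative M.lattice →* ℂˣ, (∀ x, χ x ^ ℓ = torusPart η x) ∧
      ∀ q ∈ (rootLattice P).addSubgroupOf M.lattice, χ (.ofAdd q) ^ 2 = 1 := by
  constructor
  · rintro ⟨V, _, _, f, hV⟩
    have : Module.Finite ℂ V := Module.finite_of_finrank_eq_succ hV
    let e : V ≃ₗ[ℂ] ℂ := LinearEquiv.ofFinrankEq V ℂ (by rw [hV, Module.finrank_self])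
    -- Endomorphisms of a line are scalars.
    let toC : Module.End ℂ V →ₐ[ℂ] ℂ :=
      (AlgEquiv.ofBijective (Algebra.ofId ℂ (Module.End ℂ V)) (by
        refine ⟨fun x y hxy => ?_, fun φ => ?_⟩
        · have := congrArg e (LinearMap.congr_fun hxy (e.symm 1))
          simpa [Algebra.ofId_apply, Module.algebraMap_end_apply] using this
        · refine ⟨e (φ (e.symm 1)), LinearMap.ext fun v => e.injective ?_⟩
          have hv : v = e v • e.symm 1 := e.injective (by simp)
          rw [Algebra.ofId_apply, Module.algebraMap_end_apply, map_smul]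
          conv_rhs => rw [hv, map_smul, map_smul]
          rw [smul_eq_mul, smul_eq_mul, mul_comm])).symm
    refine exists_character_of_algHom hq hε η (toC.comp (f.comp (RingQuot.mkAlgHom ℂ _)))
      fun c hc => ?_
    have : RingQuot.mkAlgHom ℂ (fun x y : U ε b M => (∃ c : Z0 ε ℓ b M w, η c = 0 ∧ x = c) ∧ y = 0)
        (c : U ε b M) = 0 := by
      rw [RingQuot.mkAlgHom_rel ℂ (y := 0) ⟨⟨c, hc, rfl⟩, rfl⟩, map_zero]
    simp only [AlgHom.comp_apply, this, map_zero]
  · rintro ⟨χ, h1, h2⟩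
    obtain ⟨f, hf⟩ := exists_algHom_of_character η hℓ hE hF χ h1 h2
    refine ⟨ℂ, inferInstance, inferInstance, (Algebra.ofId ℂ (Module.End ℂ ℂ)).comp
      (RingQuot.liftAlgHom ℂ ⟨f, ?_⟩), Module.finrank_self ℂ⟩
    rintro x y ⟨⟨c, hc, rfl⟩, rfl⟩
    rw [hf, hc, map_zero]

end

end QEA

namespace QEA

open Module

/-! ### Reduced words -/

section Words

variable {ι V N : Type*} [AddCommGroup V] [Module ℂ V] [AddCommGroup N] [Module ℂ N]
  {P : RootPairing ι ℂ V N}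

lemma reflectionPerm_conj (i j : ι) :
    P.reflectionPerm (P.reflectionPerm j i) =
      P.reflectionPerm j * P.reflectionPerm i * P.reflectionPerm j := by
  ext k
  refine P.root.injective ?_
  rw [P.root_reflectionPerm, P.reflection_reflectionPerm]
  simp [P.root_reflectionPerm]

variable {b : P.Base}

lemma wordPerm_cons (i : b.support) (u : List b.support) :
    wordPerm (i :: u) = P.reflectionPerm (i : ι) * wordPerm u := by
  simp [wordPerm]

lemma wordPerm_append (u v : List b.support) :
    wordPerm (u ++ v) = wordPerm u * wordPerm v := by
  simp [wordPerm]

lemma reflectionPerm_wordPerm (u : List b.support) (i : ι) :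
    P.reflectionPerm (wordPerm u i) = wordPerm u * P.reflectionPerm i * (wordPerm u)⁻¹ := by
  induction u with
  | nil => simp [wordPerm]
  | cons j u ih =>
    rw [wordPerm_cons, Equiv.Perm.mul_apply, reflectionPerm_conj, ih, mul_inv_rev,
      P.reflectionPerm_inv]
    simp only [mul_assoc]

variable [P.IsReduced] [P.IsCrystallographic] [Finite ι]

lemma eq_of_isPos_of_not_isPos {i : ι} {j : b.support} (hi : b.IsPos i)
    (h : ¬ b.IsPos (P.reflectionPerm j i)) : i = j := by
  by_contra hij
  exact h (hi.reflectionPerm j.2 hij)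

/-- The exchange property. -/
lemma exists_shorter_word {j : b.support} : ∀ u : List b.support, ¬ b.IsPos (wordPerm u j) →
    ∃ u' : List b.support, u'.length < u.length ∧
      wordPerm u' = wordPerm u * P.reflectionPerm (j : ι)
  | [], h => absurd (b.isPos_of_mem_support j.2) (by simpa [wordPerm] using h)
  | i :: u, h => by
    by_cases hu : b.IsPos (wordPerm u j)
    · rw [wordPerm_cons, Equiv.Perm.mul_apply] at h
      -- A simple reflection makes only its own simple root negative, so `u(α_j) = α_i`. Hence `s_i
      -- u = u s_j`, and the letter `i` can be dropped.
      have e := eq_of_isPos_of_not_isPos hu h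
      have e2 := reflectionPerm_wordPerm u (j : ι)
      rw [e] at e2
      refine ⟨u, by simp, ?_⟩
      rw [wordPerm_cons, mul_assoc]
      have e3 : wordPerm u * P.reflectionPerm (j : ι) = P.reflectionPerm (i : ι) * wordPerm u := by
        rw [e2]; group
      rw [e3, ← mul_assoc, ← sq, P.reflectionPerm_sq, one_mul]
    · obtain ⟨u', h1, h2⟩ := exists_shorter_word u hu
      exact ⟨i :: u', by simpa using h1, by rw [wordPerm_cons, h2, wordPerm_cons, mul_assoc]⟩

/-- A word of minimal length among those representing the same element. -/
def IsReducedWord (w : List b.support) : Prop :=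
  ∀ w' : List b.support, wordPerm w' = wordPerm w → w.length ≤ w'.length

/-- Otherwise the exchange property would shorten the segment formed by `u` and `j`. -/
lemma IsReducedWord.isPos {a u c : List b.support} {j : b.support}
    (h : IsReducedWord (a ++ u ++ j :: c)) : b.IsPos (wordPerm u j) := by
  by_contra hu
  obtain ⟨u', h1, h2⟩ := exists_shorter_word u hu
  have := h (a ++ u' ++ c) (by
    simp only [wordPerm_append, wordPerm_cons, h2, mul_assoc])
  simp only [List.length_append, List.length_cons] at this
  omega

lemma IsReducedWord.isPos_wordRoot {w : List b.support} (h : IsReducedWord w)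
    (k : Fin w.length) : b.IsPos (wordRoot w k) := by
  refine IsReducedWord.isPos (a := []) (c := w.drop (k + 1)) ?_
  have : w = [] ++ w.take k ++ w.get k :: w.drop (k + 1) := by simp
  rwa [← this]

/-- If `β_k = β_l`, cancelling the common prefix shows that the segment strictly between the two
letters sends `α_{i_l}` to `-α_{i_k}`, against positivity along a reduced word. -/
lemma IsReducedWord.wordRoot_ne {w : List b.support} (h : IsReducedWord w)
    {k l : Fin w.length} (hkl : k < l) : wordRoot w k ≠ wordRoot w l := by
  intro e
  obtain ⟨u, hu⟩ : ∃ u, w.take l = w.take k ++ w.get k :: u := by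
    refine ⟨(w.take l).drop (k + 1), ?_⟩
    have h1 : w.take k = (w.take l).take k := by
      rw [List.take_take, min_eq_left (Fin.val_fin_le.mpr hkl.le)]
    have hk : (k : ℕ) < (w.take l).length := by simp; omega
    have h2 : w.get k = (w.take l)[(k : ℕ)] := by simp
    rw [h1, h2, List.cons_getElem_drop_succ, List.take_append_drop]
  have hpos : b.IsPos (wordPerm u (w.get l)) := by
    refine IsReducedWord.isPos (a := w.take k ++ [w.get k]) (c := w.drop (l + 1)) ?_
    have : w = w.take k ++ [w.get k] ++ u ++ w.get l :: w.drop (l + 1) := by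
      rw [List.append_assoc (w.take k), List.singleton_append, ← hu]
      simp
    rwa [← this]
  rw [wordRoot, wordRoot, hu, wordPerm_append, wordPerm_cons, Equiv.Perm.mul_apply,
    Equiv.Perm.mul_apply] at e
  have e2 := congrArg (P.reflectionPerm (w.get k : ι)) ((wordPerm (w.take k)).injective e)
  rw [P.reflectionPerm_self] at e2
  rw [← e2] at hpos
  let := P.indexNeg
  exact (RootPairing.Base.IsPos.neg_iff_not (b := b) (w.get k : ι)).mp hpos
    (b.isPos_of_mem_support (w.get k).2)

lemma IsReducedWord.wordRoot_injective {w : List b.support} (h : IsReducedWord w) :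
    Function.Injective (wordRoot w) := by
  intro k l e
  rcases lt_trichotomy k l with hkl | hkl | hkl
  · exact absurd e (h.wordRoot_ne hkl)
  · exact hkl
  · exact absurd e.symm (h.wordRoot_ne hkl)

end Words

/-! ### Matrices filtered by a height function -/

section Filtration

variable {κ : Type*} (h : κ → ℝ)

/-- The matrices that raise the height by at least `n`. -/
def heightFilt (n : ℝ) : Submodule ℂ (Matrix κ κ ℂ) where
  carrier := {A | ∀ i j, A i j ≠ 0 → h j + n ≤ h i}
  zero_mem' i j hij := absurd rfl hij
  add_mem' {A B} hA hB i j hij := by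
    by_cases h0 : A i j = 0
    · exact hB i j fun h1 => hij (by simp [h0, h1])
    · exact hA i j h0
  smul_mem' c A hA i j hij := hA i j fun h1 => hij (by simp [h1])

variable {h} {m n : ℝ} {A B : Matrix κ κ ℂ}

lemma heightFilt_anti (hmn : m ≤ n) : heightFilt h n ≤ heightFilt h m :=
  fun _ hA i j hij => by linarith [hA i j hij]

variable [Fintype κ]

lemma mul_mem_heightFilt (hA : A ∈ heightFilt h m) (hB : B ∈ heightFilt h n) :
    A * B ∈ heightFilt h (m + n) := by
  intro i j hij
  rw [Matrix.mul_apply] at hij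
  obtain ⟨k, -, hk⟩ := Finset.exists_ne_zero_of_sum_ne_zero hij
  linarith [hA i k (left_ne_zero_of_mul hk), hB k j (right_ne_zero_of_mul hk)]

variable [DecidableEq κ]

omit [Fintype κ] in
lemma one_mem_heightFilt : (1 : Matrix κ κ ℂ) ∈ heightFilt h 0 := by
  intro i j hij
  have : i = j := by
    by_contra h
    exact hij (Matrix.one_apply_ne h)
  simp [this]

lemma pow_mem_heightFilt (hA : A ∈ heightFilt h n) (k : ℕ) : A ^ k ∈ heightFilt h (k * n) := by
  induction k with
  | zero => simpa using one_mem_heightFilt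
  | succ k ih =>
    rw [pow_succ]
    convert mul_mem_heightFilt ih hA using 2
    push_cast; ring

/-- Height differences are bounded, so `A` is nilpotent and the series is finite; the remaining
terms have at least two factors `A`. -/
lemma exp_sub_mem_heightFilt (hn : 0 < n) (hA : A ∈ heightFilt h n) :
    NormedSpace.exp A - 1 - A ∈ heightFilt h (2 * n) := by
  obtain ⟨C, hC⟩ : ∃ C : ℝ, ∀ i j, h i - h j ≤ C := by
    obtain ⟨C, hC⟩ := (Set.finite_range fun q : κ × κ => h q.1 - h q.2).bddAbove
    exact ⟨C, fun i j => hC ⟨(i, j), rfl⟩⟩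
  obtain ⟨J, hJ⟩ := exists_nat_gt (C / n)
  have hz : ∀ k, J ≤ k → A ^ k = 0 := by
    intro k hk
    ext i j
    by_contra hij
    have h1 := pow_mem_heightFilt hA k i j hij
    have h2 := hC i j
    rw [div_lt_iff₀ hn] at hJ
    have : (J : ℝ) * n ≤ k * n := by gcongr
    linarith
  have e : NormedSpace.exp A = ∑ k ∈ Finset.range (J + 2), ((k.factorial : ℂ)⁻¹) • A ^ k := by
    rw [NormedSpace.exp_eq_tsum ℂ]
    refine tsum_eq_sum fun k hk => ?_
    rw [hz k (by simp at hk; omega), smul_zero]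
  rw [e, Finset.sum_range_succ', Finset.sum_range_succ']
  have e2 : ∑ k ∈ Finset.range J, (((k + 1 + 1).factorial : ℂ)⁻¹) • A ^ (k + 1 + 1) +
      (((0 + 1).factorial : ℂ)⁻¹) • A ^ (0 + 1) + ((Nat.factorial 0 : ℂ)⁻¹) • A ^ 0 - 1 - A =
      ∑ k ∈ Finset.range J, (((k + 1 + 1).factorial : ℂ)⁻¹) • A ^ (k + 1 + 1) := by
    simp
  rw [e2]
  refine Submodule.sum_mem _ fun k _ => Submodule.smul_mem _ _ ?_
  refine heightFilt_anti ?_ (pow_mem_heightFilt hA _)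
  push_cast
  nlinarith [(Nat.cast_nonneg k : (0 : ℝ) ≤ k)]

lemma coe_expGL : (expGL A : Matrix κ κ ℂ) = NormedSpace.exp A := rfl

/-- A product of exponentials agrees to first order with the sum of the exponents. -/
lemma prod_expGL_sub_mem_heightFilt {I : Type*} (A : I → Matrix κ κ ℂ) (hn : 1 ≤ n)
    (L : List I) (hA : ∀ k ∈ L, A k ∈ heightFilt h n) :
    ((((L.map fun k => expGL (A k)).prod : GL κ ℂ)) : Matrix κ κ ℂ) - 1 - (L.map A).sum ∈
      heightFilt h (n + 1) := by
  induction L with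
  | nil => simp
  | cons k L ih =>
    have h1 := exp_sub_mem_heightFilt (by linarith) (hA k (by simp))
    have h2 := ih fun l hl => hA l (by simp [hl])
    set Q : Matrix κ κ ℂ := Units.val (L.map fun k => expGL (A k)).prod
    have hsum : (L.map A).sum ∈ heightFilt h n :=
      list_sum_mem (by
        intro x hx
        obtain ⟨l, hl, rfl⟩ := List.mem_map.mp hx
        exact hA l (by simp [hl]))
    have hQ : Q - 1 ∈ heightFilt h n := by
      have := Submodule.add_mem _ (heightFilt_anti (by linarith : n ≤ n + 1) h2) hsum
      simpa using this
    have hk : NormedSpace.exp (A k) - 1 ∈ heightFilt h n := by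
      have := Submodule.add_mem _ (heightFilt_anti (by linarith : n ≤ 2 * n) h1) (hA k (by simp))
      simpa using this
    have e : ((((k :: L).map fun k => expGL (A k)).prod : GL κ ℂ) : Matrix κ κ ℂ) - 1 -
        ((k :: L).map A).sum = (NormedSpace.exp (A k) - 1) * (Q - 1) +
          (NormedSpace.exp (A k) - 1 - A k) + (Q - 1 - (L.map A).sum) := by
      simp only [List.map_cons, List.prod_cons, List.sum_cons, Units.val_mul, coe_expGL]
      change NormedSpace.exp (A k) * Q - 1 - _ = _
      noncomm_ring
    rw [e]
    exact Submodule.add_mem _ (Submodule.add_mem _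
      (heightFilt_anti (by linarith) (mul_mem_heightFilt hk hQ))
      (heightFilt_anti (by linarith) h1)) h2

/-- Matrices that are homogeneous of positive degree with disjoint supports vanish if a
product of their exponentials is trivial. -/
lemma eq_zero_of_prod_expGL_eq_one {I : Type*} (A : I → Matrix κ κ ℂ) (d : I → ℝ)
    (hd : ∀ k, 1 ≤ d k) (hA : ∀ k i j, A k i j ≠ 0 → h i = h j + d k)
    (hdisj : ∀ k l i j, A k i j ≠ 0 → A l i j ≠ 0 → k = l) {L : List I} (hL : L.Nodup)
    (hprod : (L.map fun k => expGL (A k)).prod = 1) : ∀ k ∈ L, A k = 0 := by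
  classical
  by_contra! hcon
  -- For a nonzero matrix of least degree, the product is one plus the sum of the matrices up to
  -- terms of degree at least one higher; disjoint supports let its entries be read off that sum.
  obtain ⟨k, hk, hmin⟩ := (L.toFinset.filter fun k => A k ≠ 0).exists_min_image d (by
    obtain ⟨k, hk, hk0⟩ := hcon
    exact ⟨k, by simp [hk, hk0]⟩)
  simp only [Finset.mem_filter, List.mem_toFinset] at hk hmin
  have hmem : ∀ l ∈ L, A l ∈ heightFilt h (d k) := by
    intro l hl i j hij
    have h0 : A l ≠ 0 := fun h0 => hij (by simp [h0])
    linarith [hA l i j hij, hmin l ⟨hl, h0⟩]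
  have h1 := prod_expGL_sub_mem_heightFilt A (hd k) L hmem
  rw [hprod, Units.val_one, sub_self, zero_sub] at h1
  obtain ⟨i, j, hij⟩ : ∃ i j, A k i j ≠ 0 := by
    by_contra! h0
    exact hk.2 (Matrix.ext h0)
  have h2 : (L.map A).sum i j = A k i j := by
    rw [← List.sum_toFinset _ hL, Matrix.sum_apply]
    refine Finset.sum_eq_single k (fun l _ hlk => ?_) fun hkL => ?_
    · by_contra h0
      exact hlk (hdisj l k i j h0 hij)
    · exact absurd (List.mem_toFinset.mpr hk.1) hkL
  have h3 := h1 i j (by rw [Matrix.neg_apply, h2]; exact neg_ne_zero.mpr hij)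
  linarith [hA k i j hij]

/-- Uniqueness of the triangular decomposition, for elements of degree zero. -/
lemma eq_of_triangular {u v z D : Matrix κ κ ℂ} (hu : u - 1 ∈ heightFilt (fun i => -h i) 1)
    (hv : v - 1 ∈ heightFilt h 1) (hz : ∀ i j, z i j ≠ 0 → h i = h j)
    (hD : ∀ i j, D i j ≠ 0 → h i = h j) (e : u * z = D * v) :
    z = D ∧ u * z = z ∧ D * v = D := by
  have hz0 : z ∈ heightFilt (fun i => -h i) 0 := fun i j hij => by simp [hz i j hij]
  have hD0 : D ∈ heightFilt h 0 := fun i j hij => by simp [hD i j hij]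
  have h1 := mul_mem_heightFilt hu hz0
  have h2 := mul_mem_heightFilt hD0 hv
  -- The outer products strictly lower and strictly raise the height, while `z` and `D` preserve it,
  -- so the identity splits by degree.
  have e2 : (u - 1) * z + z = D * (v - 1) + D := by
    rw [sub_mul, mul_sub, one_mul, mul_one, sub_add_cancel, sub_add_cancel, e]
  have a1 : (u - 1) * z = 0 := by
    ext i j
    by_contra hij
    have h3 := h1 i j hij
    have h4 : z i j = 0 := by by_contra h; have := hz i j h; dsimp only at h3; linarith
    have h5 : D i j = 0 := by by_contra h; have := hD i j h; dsimp only at h3; linarith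
    have h6 := congrFun (congrFun e2 i) j
    rw [Matrix.add_apply, Matrix.add_apply, h4, h5, add_zero, add_zero] at h6
    have h7 := h2 i j (h6 ▸ hij)
    dsimp only at h3
    linarith
  have a2 : D * (v - 1) = 0 := by
    ext i j
    by_contra hij
    have h3 := h2 i j hij
    have h4 : z i j = 0 := by by_contra h; have := hz i j h; linarith
    have h5 : D i j = 0 := by by_contra h; have := hD i j h; linarith
    have h6 := congrFun (congrFun e2 i) j
    rw [a1, Matrix.add_apply, Matrix.add_apply, h4, h5, add_zero, add_zero] at h6
    exact hij h6.symm
  rw [a1, a2, zero_add, zero_add] at e2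
  refine ⟨e2, ?_, ?_⟩
  · rw [sub_mul, one_mul, sub_eq_zero] at a1
    exact a1
  · rw [mul_sub, mul_one, sub_eq_zero] at a2
    exact a2

end Filtration

end QEA

/-! ### Weights and heights in a realization of `G_M`. -/

namespace QEA

open Module

section

variable {ι V N : Type*} [AddCommGroup V] [Module ℂ V] [AddCommGroup N] [Module ℂ N]
  {P : RootPairing ι ℂ V N} [P.IsRootSystem]

/-- The linear functional that takes the value one at every simple root. -/
def heightFunctional (b : P.Base) : V →ₗ[ℂ] ℂ :=
  b.toWeightBasis.constr ℂ fun _ => (1 : ℂ)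

lemma heightFunctional_root (b : P.Base) (i : ι) :
    heightFunctional b (P.root i) = (b.height i : ℂ) := by
  obtain ⟨f, -, -, hf⟩ := b.exists_root_eq_sum_int i
  have h1 : ∀ j : b.support, heightFunctional b (P.root (j : ι)) = 1 := by
    intro j
    have := b.toWeightBasis.constr_basis ℂ (fun _ => (1 : ℂ)) j
    rwa [RootPairing.Base.toWeightBasis_apply] at this
  rw [RootPairing.Base.height_eq_sum hf, hf, map_sum, Int.cast_sum]
  refine Finset.sum_congr rfl fun j hj => ?_
  rw [map_zsmul, h1 ⟨j, hj⟩]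
  simp

end

variable {𝔤 : Type*} [LieRing 𝔤] [LieAlgebra ℂ 𝔤] [FiniteDimensional ℂ 𝔤]
  [LieAlgebra.IsKilling ℂ 𝔤] {H : LieSubalgebra ℂ 𝔤} [H.IsCartanSubalgebra]
  {M : IsogenyLattice (LieAlgebra.IsKilling.rootSystem H)}
  {κ : Type*} [Fintype κ] [DecidableEq κ]

namespace Realization

/-- The height of a weight of the representation. -/
def height (R : Realization H M κ) (b : (LieAlgebra.IsKilling.rootSystem H).Base) (k : κ) : ℝ :=
  (heightFunctional b (R.wt k : Dual ℂ H)).re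

/-- This compares the entries of both sides of `[t, x] = α(t) x`, with `t` acting diagonally. -/
lemma wt_eq_add (R : Realization H M κ) {α : LieModule.Weight ℂ H 𝔤} {x : 𝔤}
    (hx : x ∈ LieAlgebra.rootSpace H α) {i j : κ} (hij : R.rho x i j ≠ 0) :
    (R.wt i : Dual ℂ H) = R.wt j + α.toLinear := by
  ext t
  have h1 : R.rho ⁅(t : 𝔤), x⁆ = α t • R.rho x := by
    change R.rho ⁅t, x⁆ = _
    rw [LieAlgebra.IsKilling.lie_eq_smul_of_mem_rootSpace hx t, map_smul]
  rw [R.rho_lie, R.rho_cartan] at h1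
  have h2 := congrFun (congrFun h1 i) j
  rw [Matrix.sub_apply, Matrix.diagonal_mul, Matrix.mul_diagonal, Matrix.smul_apply,
    smul_eq_mul, mul_comm (R.rho x i j), ← sub_mul] at h2
  have h3 := mul_right_cancel₀ hij h2
  rw [LinearMap.add_apply, LieModule.Weight.toLinear_apply, ← h3]
  ring

lemma height_eq_add (R : Realization H M κ) (b : (LieAlgebra.IsKilling.rootSystem H).Base)
    {a : H.root} {x : 𝔤} (hx : x ∈ LieAlgebra.rootSpace H a.1) {i j : κ} (hij : R.rho x i j ≠ 0) :
    R.height b i = R.height b j + b.height a := by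
  have h := R.wt_eq_add hx hij
  have h2 : heightFunctional b (a.1.toLinear) = (b.height a : ℂ) := heightFunctional_root b a
  rw [height, height, h, map_add, h2]
  simp

lemma height_eq_sub (R : Realization H M κ) (b : (LieAlgebra.IsKilling.rootSystem H).Base)
    {a : H.root} {x : 𝔤}
    (hx : x ∈ LieAlgebra.rootSpace H (-a.1 : LieModule.Weight ℂ H 𝔤))
    {i j : κ} (hij : R.rho x i j ≠ 0) : R.height b j = R.height b i + b.height a := by
  have h := R.wt_eq_add hx hij
  have h2 : heightFunctional b (a.1.toLinear) = (b.height a : ℂ) := heightFunctional_root b a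
  have h3 : (-a.1 : LieModule.Weight ℂ H 𝔤).toLinear = -a.1.toLinear := by
    ext t; simp
  rw [h3] at h
  rw [height, height, h, map_add, map_neg, h2]
  simp

lemma weight_induction (R : Realization H M κ) {p : M.lattice → Prop} (h0 : p 0)
    (hwt : ∀ k, p (R.weight k)) (hadd : ∀ x y, p x → p y → p (x + y)) (hneg : ∀ x, p x → p (-x))
    (x : M.lattice) : p x := by
  obtain ⟨x, hx⟩ := x
  have key : ∀ y (hy : y ∈ AddSubgroup.closure (Set.range R.wt)),
      ∃ hy' : y ∈ M.lattice, p ⟨y, hy'⟩ := by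
    intro y hy
    induction hy using AddSubgroup.closure_induction with
    | mem y hy =>
      obtain ⟨k, rfl⟩ := hy
      exact ⟨_, hwt k⟩
    | zero => exact ⟨zero_mem _, h0⟩
    | add y z _ _ h1 h2 =>
      obtain ⟨h1, h1'⟩ := h1
      obtain ⟨h2, h2'⟩ := h2
      exact ⟨add_mem h1 h2, hadd _ _ h1' h2'⟩
    | neg y _ h1 =>
      obtain ⟨h1, h1'⟩ := h1
      exact ⟨neg_mem h1, hneg _ h1'⟩
  obtain ⟨_, h⟩ := key x (R.closure_wt ▸ hx)
  exact h

lemma coe_torus (R : Realization H M κ) (t : Multiplicative M.lattice →* ℂˣ) :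
    (R.torus t : Matrix κ κ ℂ) = Matrix.diagonal fun k => (t (.ofAdd (R.weight k)) : ℂ) := rfl

/-- The kernel is an ideal. Were it all of `𝔤`, every weight would vanish and so would `M`, which
contains the roots. -/
lemma rho_ne_zero [LieAlgebra.IsSimple ℂ 𝔤] [Nonempty H.root] (R : Realization H M κ) {x : 𝔤}
    (hx : x ≠ 0) : R.rho x ≠ 0 := by
  let I : LieIdeal ℂ 𝔤 :=
    { LinearMap.ker R.rho with
      lie_mem := fun {y m} hm => by
        have hm' : R.rho m = 0 := hm
        change R.rho ⁅y, m⁆ = 0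
        rw [R.rho_lie, hm', mul_zero, zero_mul, sub_zero] }
  intro h0
  rcases LieAlgebra.IsSimple.eq_bot_or_eq_top (R := ℂ) I with h | h
  · have : x ∈ I := h0
    rw [h] at this
    exact hx this
  · have hall : ∀ y, R.rho y = 0 := fun y => by
      have : y ∈ I := by rw [h]; exact LieSubmodule.mem_top y
      exact this
    obtain ⟨a⟩ := ‹Nonempty H.root›
    have hwt : ∀ k, R.weight k = 0 := by
      intro k
      refine Subtype.ext (Subtype.ext (LinearMap.ext fun t => ?_))
      have := congrFun (congrFun ((R.rho_cartan t).symm.trans (hall t)) k) k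
      rw [Matrix.diagonal_apply_eq] at this
      exact this
    have hM : M.root a = 0 := R.weight_induction (p := fun x => x = 0) rfl hwt
      (fun x y hx hy => by rw [hx, hy, add_zero]) (fun x hx => by rw [hx, neg_zero]) _
    exact (LieAlgebra.IsKilling.rootSystem H).ne_zero a
      (congrArg Subtype.val (congrArg Subtype.val hM))

lemma torus_eq_one_iff (R : Realization H M κ) (s : Multiplicative M.lattice →* ℂˣ) :
    (∀ k, s (.ofAdd (R.weight k)) = 1) ↔ ∀ x, s x = 1 :=
  ⟨fun h x => R.weight_induction (p := fun x => s (.ofAdd x) = 1) (map_one s) h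
    (fun x y hx hy => by rw [ofAdd_add, map_mul, hx, hy, one_mul])
    (fun x hx => by rw [ofAdd_neg, map_inv, hx, inv_one]) x.toAdd, fun h k => h _⟩

/-- The character `μ ↦ 2 ^ ⟨μ, α_i^∨⟩`. -/
def twoPowCharacter (i : H.root) : Multiplicative M.lattice →* ℂˣ :=
  MonoidHom.mk' (fun x => (Units.mk0 (2 : ℂ) two_ne_zero) ^
    wtPairingHom (LieAlgebra.IsKilling.rootSystem H) i (x.toAdd : weightLattice _)) fun x y => by
      rw [toAdd_mul, AddSubgroup.coe_add, map_add, zpow_add]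

/-- A matrix commuting with the torus preserves the weight spaces. -/
lemma weight_eq_of_commute (R : Realization H M κ)
    (b : (LieAlgebra.IsKilling.rootSystem H).Base) {z : Matrix κ κ ℂ}
    (hz : ∀ t, Commute z (R.torus t : Matrix κ κ ℂ)) {i j : κ} (hij : z i j ≠ 0) :
    R.wt i = R.wt j := by
  refine weight_ext b fun a => ?_
  have h := hz (twoPowCharacter (a : H.root))
  have h2 := congrFun (congrFun h.eq i) j
  rw [coe_torus, Matrix.mul_diagonal, Matrix.diagonal_mul, mul_comm] at h2
  have h3 := mul_right_cancel₀ hij h2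
  simp only [twoPowCharacter, MonoidHom.mk'_apply, Units.val_zpow_eq_zpow_val, Units.val_mk0] at h3
  have h4 : (2 : ℂ) ^ wtPairing (R.wt j) (a : H.root) = 2 ^ wtPairing (R.wt i) (a : H.root) := h3
  -- Taking absolute values moves the equation to the reals, where powers of `2` are injective in
  -- the exponent.
  have h5 : (2 : ℝ) ^ wtPairing (R.wt j) (a : H.root) = 2 ^ wtPairing (R.wt i) (a : H.root) := by
    simpa only [norm_zpow, RCLike.norm_ofNat] using congrArg norm h4
  exact (zpow_right_injective₀ (by norm_num) (by norm_num) h5).symm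

end Realization

/-! ### Central values of `π_M`. -/

section PiMap

variable {b : (LieAlgebra.IsKilling.rootSystem H).Base} {w : List b.support} {ε : ℂ} {ℓ : ℕ}

lemma IsReducedLongest.isReducedWord (hw : IsReducedLongest w) : IsReducedWord w := hw.length_le

lemma wordRoot_height_ge (hw : IsReducedWord w) (k : Fin w.length) :
    (1 : ℝ) ≤ b.height (wordRoot w k) := by
  have : 0 < b.height (wordRoot w k) := hw.isPos_wordRoot k
  exact_mod_cast this

lemma rootOf_toLinear_injective (hw : IsReducedWord w) {k l : Fin w.length}
    (h : (rootOf w k).toLinear = (rootOf w l).toLinear) : k = l :=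
  hw.wordRoot_injective ((LieAlgebra.IsKilling.rootSystem H).root.injective h)

variable (R : Realization H M κ) (X : RootVectors w) (η : Z0 ε ℓ b M w →ₐ[ℂ] ℂ)

lemma coe_upperPart : (upperPart R X η : GL κ ℂ) =
    ((List.finRange w.length).map fun k => expGL (R.rho (η (zE ε ℓ b M w k) • X.e k))).prod := by
  rw [upperPart, List.ofFn_eq_map, Subgroup.val_list_prod, List.map_map]
  rfl

lemma coe_lowerPart : (lowerPart R X η : GL κ ℂ) =
    ((List.finRange w.length).reverse.map
      fun k => expGL (R.rho (η (zF ε ℓ b M w k) • X.f k))).prod := by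
  rw [lowerPart, List.ofFn_eq_map, Subgroup.val_list_prod, ← List.map_reverse, List.map_map]
  rfl

lemma rho_e_degree {k : Fin w.length} {c : ℂ} {i j : κ} (h : R.rho (c • X.e k) i j ≠ 0) :
    R.height b i = R.height b j + b.height (wordRoot w k) :=
  R.height_eq_add b (Submodule.smul_mem _ c (X.e_mem k)) h

lemma rho_f_degree {k : Fin w.length} {c : ℂ} {i j : κ} (h : R.rho (c • X.f k) i j ≠ 0) :
    -R.height b i = -R.height b j + b.height (wordRoot w k) := by
  have := R.height_eq_sub b (a := wordRoot w k) (Submodule.smul_mem _ c (X.f_mem k)) h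
  linarith

lemma sub_one_mem_of_prod {h : κ → ℝ} {I : Type*} (A : I → Matrix κ κ ℂ) (L : List I)
    (hA : ∀ k ∈ L, A k ∈ heightFilt h 1) :
    (Units.val (L.map fun k => expGL (A k)).prod : Matrix κ κ ℂ) - 1 ∈ heightFilt h 1 := by
  have h1 := prod_expGL_sub_mem_heightFilt A le_rfl L hA
  have h2 : (L.map A).sum ∈ heightFilt h 1 := list_sum_mem (by
    intro x hx
    obtain ⟨l, hl, rfl⟩ := List.mem_map.mp hx
    exact hA l hl)
  have := Submodule.add_mem _ (heightFilt_anti (by norm_num) h1) h2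
  simpa using this

variable [LieAlgebra.IsSimple ℂ 𝔤] [Nonempty H.root]

/-- If `π_M η` is central, then the unipotent parts of `η` vanish, and `π_M η` is the square of the
torus part. -/
lemma piMap_central (hw : IsReducedWord w) {z : R.group} (hz : z ∈ Subgroup.center R.group)
    (hη : piMap R X η = z) :
    (∀ k, η (zE ε ℓ b M w k) = 0) ∧ (∀ k, η (zF ε ℓ b M w k) = 0) ∧
      (z : GL κ ℂ) = R.torus (torusPart η) ^ 2 := by
  set t := R.torus (torusPart η) with ht
  have hcomm : ∀ s, Commute ((z : GL κ ℂ) : Matrix κ κ ℂ) (R.torus s : Matrix κ κ ℂ) := by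
    intro s
    have := Subgroup.mem_center_iff.mp hz ⟨R.torus s, R.torus_mem s⟩
    have h2 := congrArg (fun g : R.group => ((g : GL κ ℂ) : Matrix κ κ ℂ)) this
    exact h2.symm
  set u : GL κ ℂ := (lowerPart R X η : GL κ ℂ) with hu
  set v : GL κ ℂ := (upperPart R X η : GL κ ℂ) with hv
  have e : u * z = t ^ 2 * v := by
    have h1 : (t⁻¹ * u)⁻¹ * (t * v) = (z : GL κ ℂ) := congrArg Subtype.val hη
    rw [← h1, sq, mul_inv_rev, inv_inv, mul_assoc, mul_inv_cancel_left, mul_assoc]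
  have hA : ∀ k, R.rho (η (zE ε ℓ b M w k) • X.e k) ∈ heightFilt (R.height b) 1 := by
    intro k i j hij
    have := rho_e_degree R X hij
    linarith [wordRoot_height_ge hw k]
  have hB : ∀ k, R.rho (η (zF ε ℓ b M w k) • X.f k) ∈ heightFilt (fun i => -R.height b i) 1 := by
    intro k i j hij
    have := rho_f_degree R X hij
    dsimp only
    linarith [wordRoot_height_ge hw k]
  have hv1 : (v : Matrix κ κ ℂ) - 1 ∈ heightFilt (R.height b) 1 := by
    rw [hv, coe_upperPart]
    exact sub_one_mem_of_prod _ _ fun k _ => hA k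
  have hu1 : (u : Matrix κ κ ℂ) - 1 ∈ heightFilt (fun i => -R.height b i) 1 := by
    rw [hu, coe_lowerPart]
    exact sub_one_mem_of_prod _ _ fun k _ => hB k
  have hD : ∀ i j, ((t ^ 2 : GL κ ℂ) : Matrix κ κ ℂ) i j ≠ 0 → R.height b i = R.height b j := by
    intro i j hij
    rw [Units.val_pow_eq_pow_val, ht, R.coe_torus, Matrix.diagonal_pow] at hij
    by_cases h : i = j
    · rw [h]
    · exact absurd (Matrix.diagonal_apply_ne _ h) hij
  -- Only commutation with the torus is used here: it makes `z` preserve weights.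
  have hz0 : ∀ i j, ((z : GL κ ℂ) : Matrix κ κ ℂ) i j ≠ 0 → R.height b i = R.height b j := by
    intro i j hij
    rw [Realization.height, Realization.height, R.weight_eq_of_commute b hcomm hij]
  obtain ⟨h1, h2, h3⟩ := eq_of_triangular hu1 hv1 hz0 hD (congrArg Units.val e)
  have hu' : u = 1 := mul_eq_right.mp (Units.ext h2)
  have hv' : v = 1 := mul_eq_left.mp (Units.ext h3)
  refine ⟨fun k => ?_, fun k => ?_, Units.ext h1⟩
  · rw [hv, coe_upperPart] at hv'
    -- Root vectors for distinct roots shift weights differently, so their matrices have disjoint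
    -- supports.
    have h0 := eq_zero_of_prod_expGL_eq_one _ _ (wordRoot_height_ge hw)
      (fun k i j h => rho_e_degree R X h) (fun k l i j hk hl => rootOf_toLinear_injective hw ?_)
      (List.nodup_finRange _) hv' k (List.mem_finRange k)
    · by_contra hne
      exact R.rho_ne_zero (smul_ne_zero hne (X.e_ne_zero k)) h0
    · have e1 := R.wt_eq_add (Submodule.smul_mem _ _ (X.e_mem k)) hk
      have e2 := R.wt_eq_add (Submodule.smul_mem _ _ (X.e_mem l)) hl
      exact add_left_cancel (e1.symm.trans e2)
  · rw [hu, coe_lowerPart] at hu'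
    have h0 := eq_zero_of_prod_expGL_eq_one (h := fun i => -R.height b i) _ _
      (wordRoot_height_ge hw)
      (fun k i j h => rho_f_degree R X h) (fun k l i j hk hl => rootOf_toLinear_injective hw ?_)
      (List.nodup_reverse.mpr (List.nodup_finRange _)) hu' k
      (List.mem_reverse.mpr (List.mem_finRange k))
    · by_contra hne
      exact R.rho_ne_zero (smul_ne_zero hne (X.f_ne_zero k)) h0
    · have e1 := R.wt_eq_add (Submodule.smul_mem _ _ (X.f_mem k)) hk
      have e2 := R.wt_eq_add (Submodule.smul_mem _ _ (X.f_mem l)) hl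
      have e3 := add_left_cancel (e1.symm.trans e2)
      ext t
      have := LinearMap.congr_fun e3 t
      simpa using this

/-- A torus element of the center is trivial on the simple roots. -/
lemma central_torus_root {s : Multiplicative M.lattice →* ℂˣ} {z : R.group}
    (hz : z ∈ Subgroup.center R.group) (hs : (z : GL κ ℂ) = R.torus s) (a : b.support) :
    s (.ofAdd (M.root a)) = 1 := by
  obtain ⟨x, hx, hx0⟩ := (a : H.root).1.exists_ne_zero
  have hmem : expGL (R.rho x) ∈ R.group := R.exp_mem (a : H.root).2 hx
  have h1 := congrArg (fun g : R.group => ((g : GL κ ℂ) : Matrix κ κ ℂ))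
    (Subgroup.mem_center_iff.mp hz ⟨_, hmem⟩)
  have h2 : NormedSpace.exp (R.rho x) * (R.torus s : Matrix κ κ ℂ) =
      (R.torus s : Matrix κ κ ℂ) * NormedSpace.exp (R.rho x) := by
    rw [← hs]; exact h1
  obtain ⟨i, j, hij⟩ : ∃ i j, R.rho x i j ≠ 0 := by
    by_contra! h0
    exact R.rho_ne_zero hx0 (Matrix.ext h0)
  have hdeg : ∀ {i j}, R.rho x i j ≠ 0 → R.height b i = R.height b j + 1 := by
    intro i j h
    rw [R.height_eq_add b hx h, RootPairing.Base.height_one_of_mem_support a.2, Int.cast_one]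
  have hA : R.rho x ∈ heightFilt (R.height b) 1 := fun i j h => (hdeg h).ge
  have h3 := exp_sub_mem_heightFilt one_pos hA i j
  have hne : i ≠ j := by
    rintro rfl
    linarith [hdeg hij]
  -- A simple root has height one, and in that degree only the linear term of the exponential
  -- survives.
  have h4 : NormedSpace.exp (R.rho x) i j = R.rho x i j := by
    by_contra hcon
    have := h3 (by
      rw [Matrix.sub_apply, Matrix.sub_apply, Matrix.one_apply_ne hne, sub_zero]
      exact sub_ne_zero.mpr hcon)
    linarith [hdeg hij]
  have h5 := congrFun (congrFun h2 i) j
  rw [R.coe_torus, Matrix.mul_diagonal, Matrix.diagonal_mul, h4, mul_comm] at h5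
  have h6 : s (.ofAdd (R.weight j)) = s (.ofAdd (R.weight i)) :=
    Units.ext (mul_right_cancel₀ hij h5)
  have h7 : R.weight i = R.weight j + M.root a :=
    Subtype.ext (Subtype.ext (R.wt_eq_add hx hij))
  rw [h7, ofAdd_add, map_mul] at h6
  exact (left_eq_mul.mp h6)

end PiMap

end QEA

/-! ### The order of a central element, and the conclusion. -/

namespace QEA

open Module

variable {𝔤 : Type*} [LieRing 𝔤] [LieAlgebra ℂ 𝔤] [FiniteDimensional ℂ 𝔤]
  [LieAlgebra.IsKilling ℂ 𝔤] {H : LieSubalgebra ℂ 𝔤} [H.IsCartanSubalgebra]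
  {M : IsogenyLattice (LieAlgebra.IsKilling.rootSystem H)}
  {κ : Type*} [Fintype κ] [DecidableEq κ]

/-- The order of a group element given by the square of a torus element. -/
lemma Realization.orderOf_dvd_iff (R : Realization H M κ) {t : Multiplicative M.lattice →* ℂˣ}
    {z : R.group} (hz : (z : GL κ ℂ) = R.torus t ^ 2) (n : ℕ) :
    orderOf z ∣ n ↔ ∀ x, (t x ^ 2) ^ n = 1 := by
  let s : Multiplicative M.lattice →* ℂˣ := (powMonoidHom n).comp ((powMonoidHom 2).comp t)
  refine Iff.trans ?_ (R.torus_eq_one_iff s)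
  rw [orderOf_dvd_iff_pow_eq_one, Subtype.ext_iff, SubmonoidClass.coe_pow, hz, Units.ext_iff,
    Units.val_pow_eq_pow_val, Units.val_pow_eq_pow_val, R.coe_torus, Matrix.diagonal_pow,
    Matrix.diagonal_pow, Subgroup.coe_one, Units.val_one, ← Matrix.diagonal_one,
    Matrix.diagonal_eq_diagonal_iff]
  refine forall_congr' fun k => ?_
  rw [Units.ext_iff]
  rfl

lemma nonempty_support {ι V N : Type*} [AddCommGroup V] [Module ℂ V] [AddCommGroup N] [Module ℂ N]
    {P : RootPairing ι ℂ V N} [P.IsRootSystem] [P.IsIrreducible] (b : P.Base) :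
    Nonempty b.support := by
  have := RootPairing.IsIrreducible.nontrivial (P := P)
  exact b.toWeightBasis.index_nonempty

end QEA

end

theorem proposition6p4 {𝔤 : Type*} [LieRing 𝔤] [LieAlgebra ℂ 𝔤] [FiniteDimensional ℂ 𝔤]
    [LieAlgebra.IsSimple ℂ 𝔤] (H : LieSubalgebra ℂ 𝔤) [H.IsCartanSubalgebra]
    (b : (LieAlgebra.IsKilling.rootSystem H).Base)
    (M : QEA.IsogenyLattice (LieAlgebra.IsKilling.rootSystem H))
    (ℓ : ℕ) (hℓ : 1 < ℓ) (hodd : Odd ℓ)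
    (hG2 : (LieAlgebra.IsKilling.rootSystem H).IsG2 → Nat.Coprime ℓ 3)
    (ε : ℂ) (hε : IsPrimitiveRoot ε ℓ)
    (w : List b.support) (hw : QEA.IsReducedLongest w)
    {κ : Type*} [Fintype κ] [DecidableEq κ] (R : QEA.Realization H M κ) (X : QEA.RootVectors w)
    (m d : ℕ) (hm : m = M.index) (hd : d = Nat.gcd ℓ m)
    (η : QEA.Z0 ε ℓ b M w →ₐ[ℂ] ℂ)
    (z : R.group) (hz : z ∈ Subgroup.center R.group) (hη : QEA.piMap R X η = z) :
    (∃ (V : Type) (_ : AddCommGroup V) (_ : Module ℂ V) (_ : QEA.Ured η →ₐ[ℂ] Module.End ℂ V),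
      Module.finrank ℂ V = 1) ↔ orderOf z ∣ m / d := by
  have hne := QEA.nonempty_support b
  have hroot : Nonempty H.root := hne.map Subtype.val
  obtain ⟨hE, hF, hzt⟩ := QEA.piMap_central R X η hw.isReducedWord hz hη
  -- Both sides become statements about characters of `M`.
  rw [QEA.exists_oneDim_iff (QEA.qRoot_sq_ne_one hℓ hodd hG2 hε) (hε.ne_zero hodd.pos.ne')
    hodd.pos.ne' η hE hF, R.orderOf_dvd_iff hzt, hd, hm]
  have := M.finite_quot b
  refine QEA.exists_root_character_iff ((QEA.rootLattice _).addSubgroupOf M.lattice) hodd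
    (fun p hp hpl => ?_) _ (QEA.character_sq_eq_one (b := b) _ fun a => ?_)
  · have := Fact.mk hp
    refine M.card_torsion_le b p ?_ fun hG h3 => ?_
    · rintro rfl
      exact (Nat.not_even_iff_odd.mpr hodd) (even_iff_two_dvd.mpr hpl)
    · subst h3
      exact hp.one_lt.ne' (Nat.dvd_one.mp ((hG2 hG) ▸ Nat.dvd_gcd hpl dvd_rfl))
  -- The square of the torus part is `z` itself, hence trivial on simple roots.
  · refine QEA.central_torus_root R
      (s := (powMonoidHom 2).comp (QEA.torusPart η)) hz ?_ a
    rw [hzt]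
    refine Units.ext ?_
    rw [Units.val_pow_eq_pow_val, R.coe_torus, R.coe_torus, Matrix.diagonal_pow]
    rfl
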